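/- Let $\dot x = Ax+bu$, $x\in\mathbb{R}^n$ ($n\ge 1$), $u\in\mathbb{R}$, be a controllable single-input linear system all of whose eigenvalues have zero real part. Counting multiplicities, let $s$ be the number of conjugate pairs of nonzero eigenvalues of $A$, let $z$ be the multiplicity of the eigenvalue $0$, let $\mu=s+z$, and let $\pm i\omega_1,\dots,\pm i\omega_s$ be the nonzero eigenvalues. Put $A_0=\begin{pmatrix}0&1\\-1&0\end{pmatrix}$, $b_0=\begin{pmatrix}0\\1\end{pmatrix}$ and, for positive constants $a_1,\dots,a_\mu$, $$\theta_{i,i+1}=1,\qquad \theta_{i,k}=\prod_{h=i}^{k-2}\frac1{a_{h+1}}\ \ (i+2\le k\le \mu+1),\qquad Q_{i,\mu}=\prod_{l=i}^{\mu}a_l .$$ Consider the triangular system with state $y=(y_1,\dots,y_\mu)$, $y_i\in\mathbb{R}^2$ for $i\le s$ and $y_i\in\mathbb{R}$ for $i>s$, $$\dot y_i=\omega_iA_0y_i+b_0\sum_{k=i+1}^{s}\theta_{i,k}b_0^Ty_k+b_0\sum_{k=s+1}^{\mu}\theta_{i,k}y_k+\theta_{i,\mu+1}b_0u,\quad 1\le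 i\le s,$$ $$\dot y_i=\sum_{k=i+1}^{\mu}\theta_{i,k}y_k+\theta_{i,\mu+1}u,\quad s+1\le i\le\mu$$ (so that $\dot y_\mu=u$ if $z\ge1$), and the feedback $$\kappa(y)=-\sum_{i=1}^{s}\frac{Q_{i,\mu}\,b_0^Ty_i}{\big(1+\sum_{m=i}^{\mu}\|y_m\|^2\big)^{1/2}}-\sum_{i=s+1}^{\mu}\frac{Q_{i,\mu}\,y_i}{\big(1+\sum_{m=i}^{\mu}\|y_m\|^2\big)^{1/2}} .$$ Then there exist functions $\bar a_i:\mathbb{R}_{>0}\to\mathbb{R}_{>0}$, $1\le i\le\mu-1$, such that for all constants $a_1,\dots,a_\mu$ with $a_\mu\in(0,1]$ and $a_i\in(0,\bar a_i(a_{i+1})]$ for $1\le i\le \mu-1$, the following holds, where $\dot y=F(y)$ denotes the triangular system closed with $u=\kappa(y)$. (1) The feedback $\kappa$ is $SISS_L$-stabilizing for the triangular system. That is, the origin of $\dot y=F(y)$ is globally asymptotically stable, and there are $\Delta,N>0$ such that for every $\delta\in(0,\Delta]$ and every bounded measurable signal $e:\mathbb{R}_{\ge0}\to\mathbb{R}^{2s+z}$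 with $\|e(t)\|\le\delta$ for all sufficiently large $t$, every solution of $\dot y=F(y)+e(t)$ is defined for all $t\ge 0$ and satisfies $\|y(t)\|\le N\delta$ for all sufficiently large $t$. (2) The linearization of $\dot y=F(y)$ at the origin is asymptotically stable. -/

import Mathlib

noncomputable section

namespace CriticalSystem

open MeasureTheory Filter Topology Matrix

/-! ### Solutions and stability notions -/

section Dynamics

variable {E U : Type*} [NormedAddCommGroup E] [NormedSpace ℝ E]
  [NormedAddCommGroup U] [MeasurableSpace U]

/-- `x` is a (Carathéodory) solution of `ẋ(t) = g(t, x(t))` on the interval `I` of times, where `I`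
is an interval with left end point `0`, contained in `[0, ∞)`. The integral form is equivalent to:
`x` is locally absolutely continuous on `I` and satisfies the equation almost everywhere. -/
def IsSolutionOn (g : ℝ → E → E) (I : Set ℝ) (x : ℝ → E) : Prop :=
  ∀ t ∈ I, IntervalIntegrable (fun τ => g τ (x τ)) volume 0 t ∧
    x t = x 0 + ∫ τ in (0 : ℝ)..t, g τ (x τ)

/-- Every initial condition admits a solution on `[0, ∞)`, and no solution stops in finite time:
every solution on some `[0, T)` is the restriction of a solution on `[0, ∞)`. -/
def ForwardComplete (g : ℝ → E → E) : Prop :=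
  (∀ x₀ : E, ∃ x : ℝ → E, x 0 = x₀ ∧ IsSolutionOn g (Set.Ici 0) x) ∧
  ∀ T : ℝ, 0 < T → ∀ x : ℝ → E, IsSolutionOn g (Set.Ico 0 T) x →
    ∃ x' : ℝ → E, IsSolutionOn g (Set.Ici 0) x' ∧ ∀ t ∈ Set.Ico 0 T, x' t = x t

/-- `f : ℝ_{≥ 0} → V` is eventually bounded by `δ`. -/
def EventuallyBounded {V : Type*} [Norm V] (f : ℝ → V) (δ : ℝ) : Prop :=
  ∃ T : ℝ, 0 < T ∧ ∀ t : ℝ, T ≤ t → ‖f t‖ ≤ δ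

/-- `SISS_L(Δ, N)` for the control system `ẋ = f(x, u)`: small input, small state, with linear
gain. The values of the signal `e` at negative times are irrelevant. -/
def SISSLWith (f : E → U → E) (Δ N : ℝ) : Prop :=
  ∀ δ : ℝ, 0 < δ → δ ≤ Δ → ∀ e : ℝ → U, Measurable e →
    (∃ M : ℝ, ∀ t : ℝ, 0 ≤ t → ‖e t‖ ≤ M) → EventuallyBounded e δ →
      ForwardComplete (fun t x => f x (e t)) ∧
      ∀ x : ℝ → E, IsSolutionOn (fun t x => f x (e t)) (Set.Ici 0) x →
        EventuallyBounded x (N * δ)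

/-- The control system `ẋ = f(x, u)` is `SISS_L`. -/
def SISSL (f : E → U → E) : Prop :=
  ∃ Δ N : ℝ, 0 < Δ ∧ 0 < N ∧ SISSLWith f Δ N

/-- The input-free system `ẋ = f(x)` is `SISS_L`: the control system `ẋ = f(x) + u` is. -/
def InputFreeSISSL [MeasurableSpace E] (f : E → E) : Prop :=
  SISSL (fun x u : E => f x + u)

/-- Lyapunov stability of the origin of `ẋ = f(x)`. -/
def StableOrigin (f : E → E) : Prop :=
  ∀ ε : ℝ, 0 < ε → ∃ η : ℝ, 0 < η ∧
    ∀ x : ℝ → E, IsSolutionOn (fun _ => f) (Set.Ici 0) x → ‖x 0‖ ≤ η →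
      ∀ t : ℝ, 0 ≤ t → ‖x t‖ ≤ ε

/-- Global asymptotic stability of the origin of `ẋ = f(x)`. -/
def GAS (f : E → E) : Prop :=
  ForwardComplete (fun _ => f) ∧ StableOrigin f ∧
    ∀ x : ℝ → E, IsSolutionOn (fun _ => f) (Set.Ici 0) x → Tendsto x atTop (𝓝 0)

/-- Asymptotic stability of `ẋ = L x`, for `L` linear: the origin is stable and every
solution starting near the origin converges to it (for a linear system, this is the same as
convergence of all solutions; solutions of a linear system never stop in finite time). -/
def LinearAS (L : E →L[ℝ] E) : Prop :=
  StableOrigin (fun x => L x) ∧ ∃ r : ℝ, 0 < r ∧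
    ∀ x : ℝ → E, IsSolutionOn (fun _ x => L x) (Set.Ici 0) x → ‖x 0‖ ≤ r →
      Tendsto x atTop (𝓝 0)

/-- The linearization of `ẋ = f(x)` around the origin exists and is asymptotically stable. -/
def LinearizationAS (f : E → E) : Prop :=
  ∃ L : E →L[ℝ] E, HasFDerivAt f L 0 ∧ LinearAS L

/-- The closed-loop vector field `x ↦ f(x, ν(x))`. -/
def closedLoop {W : Type*} (f : E → W → E) (ν : E → W) : E → E := fun x => f x (ν x)

/-- The feedback law `ν` is stabilizing for `ẋ = f(x, u)`. -/
def Stabilizing {W : Type*} (f : E → W → E) (ν : E → W) : Prop :=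
  GAS (closedLoop f ν)

/-- The feedback law `ν` is `SISS_L`-stabilizing for `ẋ = f(x, u)`. -/
def SISSLStabilizing {W : Type*} [MeasurableSpace E] (f : E → W → E) (ν : E → W) : Prop :=
  Stabilizing f ν ∧ InputFreeSISSL (closedLoop f ν)

end Dynamics

/-! ### Controllable pairs and critical spectra -/

section Spectrum

variable {n : ℕ}

/-- Controllability of `ẋ = A x + b u`: the matrix `[b, A b, …, A^{n-1} b]` has rank `n`. -/
def Controllable (A : Matrix (Fin n) (Fin n) ℝ) (b : Fin n → ℝ) : Prop :=
  (Matrix.of fun (i : Fin n) (k : Fin n) => ((A ^ (k : ℕ)) *ᵥ b) i).rank = n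

/-- The complex eigenvalues of a real matrix, with algebraic multiplicity. -/
def eigenvalues (A : Matrix (Fin n) (Fin n) ℝ) : Multiset ℂ :=
  (A.map (algebraMap ℝ ℂ)).charpoly.roots

/-- All eigenvalues are critical, that is, have zero real part. -/
def AllCritical (A : Matrix (Fin n) (Fin n) ℝ) : Prop :=
  ∀ l ∈ eigenvalues A, l.re = 0

open Classical in
/-- `s(A)`: number of conjugate pairs of nonzero purely imaginary eigenvalues, with multiplicity
(each pair is counted through its member in the upper half plane). -/
def numPairs (A : Matrix (Fin n) (Fin n) ℝ) : ℕ :=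
  Multiset.card ((eigenvalues A).filter fun l => l.re = 0 ∧ 0 < l.im)

open Classical in
/-- `z(A)`: multiplicity of the zero eigenvalue. -/
def zeroMult (A : Matrix (Fin n) (Fin n) ℝ) : ℕ :=
  (eigenvalues A).count 0

open Classical in
/-- `± i ω_1, …, ± i ω_s` is the list of the nonzero eigenvalues of `A`, with multiplicity. -/
def IsFrequencyList (A : Matrix (Fin n) (Fin n) ℝ) {s : ℕ} (ω : Fin s → ℝ) : Prop :=
  (eigenvalues A).filter (fun l => l ≠ 0) =
    (Finset.univ.val.map fun j : Fin s => (ω j : ℂ) * Complex.I) +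
    (Finset.univ.val.map fun j : Fin s => -((ω j : ℂ) * Complex.I))

end Spectrum

/-! ### The triangular form and its feedback law

There are `μ = s + z` blocks, numbered from `1` to `μ`: first `s` oscillators with state in `ℝ²`,
then `z` integrators with state in `ℝ`. The oscillator `j : Fin s` is block number `j + 1`, the
integrator `j : Fin z` is block number `s + j + 1`. The constants `a_1, …, a_μ` are the
values `a 1, …, a μ` of a sequence. -/

section TriangularForm

/-- The state space `(ℝ²)^s × ℝ^z`, with its Euclidean norm. -/
abbrev State (s z : ℕ) : Type := EuclideanSpace ℝ ((Fin s × Fin 2) ⊕ Fin z)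

def A₀ : Matrix (Fin 2) (Fin 2) ℝ := !![0, 1; -1, 0]

def b₀ : Fin 2 → ℝ := ![0, 1]

/-- `θ_{i,k}`: equal to `1` for `k = i + 1`, and to `∏_{h=i}^{k-2} 1 / a_{h+1}`
for `k ≥ i + 2`. -/
def theta (a : ℕ → ℝ) (i k : ℕ) : ℝ :=
  if k = i + 1 then 1 else ∏ h ∈ Finset.Icc i (k - 2), 1 / a (h + 1)

/-- `Q_{i,μ} = ∏_{l=i}^{μ} a_l`. -/
def gain (a : ℕ → ℝ) (i μ : ℕ) : ℝ := ∏ l ∈ Finset.Icc i μ, a l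

variable {s z : ℕ}

/-- The `ℝ²`-valued component of an oscillator. -/
def osc (y : State s z) (j : Fin s) : Fin 2 → ℝ := fun r => y (Sum.inl (j, r))

/-- The scalar component of an integrator. -/
def int (y : State s z) (j : Fin z) : ℝ := y (Sum.inr j)

/-- The triangular control system of oscillators and integrators. For the last block the sums
are empty and the coefficient of `u` is `1`. -/
def triSystem (ω : Fin s → ℝ) (a : ℕ → ℝ) (y : State s z) (u : ℝ) : State s z :=
  WithLp.toLp 2 (Sum.elim
    (fun p : Fin s × Fin 2 =>
      (ω p.1 • (A₀ *ᵥ osc y p.1)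
        + (∑ k ∈ Finset.univ.filter (fun k : Fin s => p.1 < k),
            theta a ((p.1 : ℕ) + 1) ((k : ℕ) + 1) * (b₀ ⬝ᵥ osc y k)) • b₀
        + (∑ k : Fin z, theta a ((p.1 : ℕ) + 1) (s + (k : ℕ) + 1) * int y k) • b₀
        + (theta a ((p.1 : ℕ) + 1) (s + z + 1) * u) • b₀) p.2)
    (fun j : Fin z =>
      (∑ k ∈ Finset.univ.filter (fun k : Fin z => j < k),
          theta a (s + (j : ℕ) + 1) (s + (k : ℕ) + 1) * int y k)
        + theta a (s + (j : ℕ) + 1) (s + z + 1) * u))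

/-- `∑_{m=i}^{μ} ‖y_m‖²`, where `i` is the block of the oscillator `j`. -/
def tailOsc (y : State s z) (j : Fin s) : ℝ :=
  (∑ m ∈ Finset.univ.filter (fun m : Fin s => j ≤ m), ∑ r : Fin 2, osc y m r ^ 2)
    + ∑ m : Fin z, int y m ^ 2

/-- `∑_{m=i}^{μ} ‖y_m‖²`, where `i` is the block of the integrator `j`. -/
def tailInt (y : State s z) (j : Fin z) : ℝ :=
  ∑ m ∈ Finset.univ.filter (fun m : Fin z => j ≤ m), int y m ^ 2

/-- The saturated-type feedback law `κ`. -/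
def kappa (a : ℕ → ℝ) (y : State s z) : ℝ :=
  -(∑ j : Fin s, gain a ((j : ℕ) + 1) (s + z) * (b₀ ⬝ᵥ osc y j) / Real.sqrt (1 + tailOsc y j))
    - (∑ j : Fin z, gain a (s + (j : ℕ) + 1) (s + z) * int y j / Real.sqrt (1 + tailInt y j))

end TriangularForm

end CriticalSystem

end

/-!
In block coordinates, with an integrator regarded as an oscillator of frequency `0` confined to its
second axis, all coefficients are quotients of the products `P k = a 1 ⋯ a k` (`weight`). In the
closed loop the linear coupling to the later blocks cancels: writing `σ` for the saturation factors
and `w` for the outputs, block `k`, numbered from `0`, is a rotation driven by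
`P (k + 1) * (∑_{m > k} (1 - σ_m) w_m / P m - ∑_{m ≤ k} σ_m w_m / P m)` (`blockOut_closedLoop`).
Hence block `k` has the saturated damping `a (k + 1) σ_k w_k`, is disturbed by the earlier blocks
through bounded terms, and by the later ones through terms of third order.

*Small inputs.* A single block has a finite gain from small disturbances to its eventual size
(`eventually_sqrt_blockSq_le`, with the Lyapunov function `S ^ 3 / 3 + p x₁ x₂`). The blocks become
small one after the other, from the last to the first; whenever a further block has become small,
the bounds on the later blocks improve by a small-gain iteration (`eventually_le_of_gain`), and at
the end all of them are proportional to the input. This only needs `a 1, …, a (μ - 1)` to be below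
one constant that depends on the frequencies, so constant functions `abar` suffice. Zero input and
arbitrarily small `δ` give attractivity of the origin.

*Linearization.* The linearization is block lower triangular with damped diagonal blocks, so a
weighted sum of quadratic Lyapunov functions of the blocks decreases along it (`exists_quadLyap`).
This gives asymptotic stability of the linearization, and stability of the origin of the closed
loop.

The closed loop is globally Lipschitz, which makes it forward complete
(`forwardComplete_of_lipschitz`). Since inputs are only measurable, solutions are only absolutely
continuous; Lyapunov functions are handled through upper Dini derivatives, for which the pointwise
bound on the input suffices (`IsSolutionOn.frequently_slope_lt`).
-/

noncomputable section

namespace CriticalSystem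

open MeasureTheory Filter Topology Set Matrix

/-! ### Existence and uniqueness of Carathéodory solutions -/

section Existence

variable {E : Type*} [NormedAddCommGroup E] [NormedSpace ℝ E]

theorem IsSolutionOn.sub_eq {g : ℝ → E → E} {x : ℝ → E} {I : Set ℝ} (hx : IsSolutionOn g I x)
    {t u : ℝ} (ht : t ∈ I) (hu : u ∈ I) :
    IntervalIntegrable (fun τ => g τ (x τ)) volume t u ∧
      x u - x t = ∫ τ in t..u, g τ (x τ) := by
  refine ⟨(hx t ht).1.symm.trans (hx u hu).1, ?_⟩
  rw [(hx t ht).2, (hx u hu).2, add_sub_add_left_eq_sub,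
    intervalIntegral.integral_interval_sub_left (hx u hu).1 (hx t ht).1]

theorem IsSolutionOn.continuousOn_Icc {g : ℝ → E → E} {x : ℝ → E} {I : Set ℝ} {T : ℝ}
    (hx : IsSolutionOn g I x) (hI : Icc 0 T ⊆ I) : ContinuousOn x (Icc 0 T) := by
  rcases lt_or_ge T 0 with hT | hT
  · simp [Icc_eq_empty (not_le.2 hT)]
  have h := intervalIntegral.continuousOn_primitive_interval' (hx T (hI (right_mem_Icc.2 hT))).1
    left_mem_uIcc
  rw [uIcc_of_le hT] at h
  exact (continuousOn_const.add h).congr fun t ht => (hx t (hI ht)).2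

theorem IsSolutionOn.continuousOn {g : ℝ → E → E} {x : ℝ → E} (hx : IsSolutionOn g (Ici 0) x) :
    ContinuousOn x (Ici 0) := by
  intro t ht
  have h := hx.continuousOn_Icc (T := t + 1) (fun _ h => h.1) t ⟨ht, by linarith⟩
  refine h.mono_of_mem_nhdsWithin ?_
  rw [← Ici_inter_Iic]
  exact inter_mem_nhdsWithin _ (Iic_mem_nhds (by linarith))

/-- Two solutions with the same right-hand side and the same initial value agree: the input cancels
in the difference, which is therefore continuously differentiable. -/
theorem IsSolutionOn.eqOn_Ico {F : E → E} [CompleteSpace E] {K : NNReal} (hF : LipschitzWith K F)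
    {e : ℝ → E} {x y : ℝ → E} {T : ℝ} (hx : IsSolutionOn (fun t x => F x + e t) (Ico 0 T) x)
    (hy : IsSolutionOn (fun t x => F x + e t) (Ico 0 T) y) (h0 : x 0 = y 0) :
    EqOn x y (Ico 0 T) := by
  intro u hu
  have hsub : Icc 0 u ⊆ Ico 0 T := fun t ht => ⟨ht.1, ht.2.trans_lt hu.2⟩
  have hxc := hx.continuousOn_Icc hsub
  have hyc := hy.continuousOn_Icc hsub
  have hFc : ContinuousOn (fun t => F (x t) - F (y t)) (Icc 0 u) :=
    (hF.continuous.comp_continuousOn hxc).sub (hF.continuous.comp_continuousOn hyc)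
  have hd : ∀ t ∈ Icc 0 u, x t - y t = ∫ τ in (0 : ℝ)..t, (F (x τ) - F (y τ)) := by
    intro t ht
    have h1 := hx t (hsub ht)
    have h2 := hy t (hsub ht)
    rw [h1.2, h2.2, h0, add_sub_add_left_eq_sub, ← intervalIntegral.integral_sub h1.1 h2.1]
    simp
  have hder : ∀ t ∈ Ico 0 u,
      HasDerivWithinAt (fun t => x t - y t) (F (x t) - F (y t)) (Ici t) t := by
    intro t ht
    have hii : IntervalIntegrable (fun τ => F (x τ) - F (y τ)) volume 0 t :=
      (hFc.mono (by rw [uIcc_of_le ht.1]; exact Icc_subset_Icc_right ht.2.le)).intervalIntegrable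
    have hev : Icc 0 u ∈ 𝓝[>] t :=
      mem_of_superset (Ioo_mem_nhdsGT ht.2) fun s hs => ⟨ht.1.trans hs.1.le, hs.2.le⟩
    have hmem : t ∈ Icc 0 u := Ico_subset_Icc_self ht
    have hcw : ContinuousWithinAt (fun τ => F (x τ) - F (y τ)) (Ioi t) t :=
      (hFc t hmem).mono_of_mem_nhdsWithin hev
    have := intervalIntegral.integral_hasDerivWithinAt_right (s := Ici t) (t := Ioi t) hii
      ⟨Icc 0 u, hev, hFc.aestronglyMeasurable measurableSet_Icc⟩ hcw
    refine this.congr_of_eventuallyEq ?_ (hd t hmem)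
    have hev' : Icc 0 u ∈ 𝓝[≥] t :=
      mem_of_superset (Ico_mem_nhdsGE ht.2) fun s hs => ⟨ht.1.trans hs.1, hs.2.le⟩
    filter_upwards [hev'] with s hs using hd s hs
  have hz := eq_zero_of_abs_deriv_le_mul_abs_self_of_eq_zero_right (K := K)
    (hxc.sub hyc) hder (by simp [h0]) (fun t _ => by
      simpa [dist_eq_norm] using hF.dist_le_mul (x t) (y t))
  exact sub_eq_zero.1 (hz u (right_mem_Icc.2 hu.1))

theorem norm_integral_le_exp {g : ℝ → E} {C l t : ℝ} (hl : 0 < l) (ht : 0 ≤ t) (hC : 0 ≤ C)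
    (hg : ∀ τ, 0 ≤ τ → ‖g τ‖ ≤ C * Real.exp (l * τ)) :
    ‖∫ τ in (0 : ℝ)..t, g τ‖ ≤ C / l * Real.exp (l * t) := by
  have h1 : ‖∫ τ in (0 : ℝ)..t, g τ‖ ≤ ∫ τ in (0 : ℝ)..t, C * Real.exp (l * τ) :=
    intervalIntegral.norm_integral_le_of_norm_le ht
      (ae_of_all _ fun τ hτ => hg τ hτ.1.le)
      (Continuous.intervalIntegrable (by fun_prop) _ _)
  have h2 : ∫ τ in (0 : ℝ)..t, C * Real.exp (l * τ) = C / l * Real.exp (l * t) - C / l := by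
    rw [intervalIntegral.integral_const_mul, intervalIntegral.integral_comp_mul_left _ hl.ne']
    simp only [mul_zero, integral_exp, Real.exp_zero, smul_eq_mul]
    field_simp
  have : 0 ≤ C / l := by positivity
  linarith

variable [CompleteSpace E]

/-- Global existence for `ẋ = F(x) + e(t)` with `F` globally Lipschitz: the solution, multiplied by
`exp (-l t)` with `l` large, is the fixed point of a contraction of the bounded continuous
functions. -/
theorem exists_isSolutionOn {F : E → E} {K : NNReal} (hF : LipschitzWith K F) {e : ℝ → E}
    (hem : AEStronglyMeasurable e volume) {M : ℝ} (he : ∀ t, ‖e t‖ ≤ M) (x₀ : E) :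
    ∃ x : ℝ → E, x 0 = x₀ ∧ IsSolutionOn (fun t x => F x + e t) (Ici 0) x := by
  set l : ℝ := 2 * K + 1 with hl
  have hlpos : 0 < l := by positivity
  have hM : 0 ≤ M := (norm_nonneg _).trans (he 0)
  let G : BoundedContinuousFunction ℝ E → ℝ → E :=
    fun ψ τ => F (Real.exp (l * τ) • ψ τ) + e τ
  have heint : ∀ a b : ℝ, IntervalIntegrable e volume a b := fun a b =>
    (intervalIntegrable_const (c := M)).mono_fun hem.restrict
      (ae_of_all _ fun t => (he t).trans (le_abs_self M))
  have hGc : ∀ ψ : BoundedContinuousFunction ℝ E,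
      Continuous fun τ => F (Real.exp (l * τ) • ψ τ) := fun ψ =>
    hF.continuous.comp (by fun_prop)
  have hGint : ∀ (ψ : BoundedContinuousFunction ℝ E) (a b : ℝ),
      IntervalIntegrable (G ψ) volume a b := fun ψ a b =>
    ((hGc ψ).intervalIntegrable a b).add (heint a b)
  have hGbd : ∀ (ψ : BoundedContinuousFunction ℝ E) (τ : ℝ), 0 ≤ τ →
      ‖G ψ τ‖ ≤ (‖F 0‖ + M + K * ‖ψ‖) * Real.exp (l * τ) := by
    intro ψ τ hτ
    have h1 : 1 ≤ Real.exp (l * τ) := Real.one_le_exp (by positivity)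
    have h2 := hF.dist_le_mul (Real.exp (l * τ) • ψ τ) 0
    rw [dist_eq_norm, dist_eq_norm, sub_zero, norm_smul, Real.norm_eq_abs, Real.abs_exp] at h2
    have h3 : ‖F (Real.exp (l * τ) • ψ τ)‖ ≤ ‖F (Real.exp (l * τ) • ψ τ) - F 0‖ + ‖F 0‖ := by
      simpa using norm_add_le (F (Real.exp (l * τ) • ψ τ) - F 0) (F 0)
    have h4 : ‖G ψ τ‖ ≤ ‖F (Real.exp (l * τ) • ψ τ)‖ + ‖e τ‖ := norm_add_le _ _
    have h5 : (K : ℝ) * (Real.exp (l * τ) * ‖ψ τ‖) ≤ K * (Real.exp (l * τ) * ‖ψ‖) := by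
      gcongr
      exact ψ.norm_coe_le_norm τ
    have h6 := he τ
    have h7 : (‖F 0‖ + M) * 1 ≤ (‖F 0‖ + M) * Real.exp (l * τ) := by gcongr
    nlinarith
  let Φ₀ : BoundedContinuousFunction ℝ E → ℝ → E := fun ψ t =>
    Real.exp (-(l * max t 0)) • (x₀ + ∫ τ in (0 : ℝ)..max t 0, G ψ τ)
  have hΦc : ∀ ψ, Continuous (Φ₀ ψ) := by
    intro ψ
    have := (intervalIntegral.continuous_primitive (hGint ψ) 0).comp
      (continuous_id.max (continuous_const (y := (0 : ℝ))))
    exact (by fun_prop : Continuous fun t : ℝ => Real.exp (-(l * max t 0))).smul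
      (continuous_const.add this)
  have hexp : ∀ t : ℝ, Real.exp (-(l * max t 0)) * Real.exp (l * max t 0) = 1 := fun t => by
    rw [← Real.exp_add]; simp
  have hexp1 : ∀ t : ℝ, Real.exp (-(l * max t 0)) ≤ 1 := fun t =>
    Real.exp_le_one_iff.2 (by have := le_max_right t 0; simp; positivity)
  have hΦb : ∀ ψ t, ‖Φ₀ ψ t‖ ≤ ‖x₀‖ + (‖F 0‖ + M + K * ‖ψ‖) / l := by
    intro ψ t
    have h1 := norm_integral_le_exp hlpos (le_max_right t 0) (by positivity) (hGbd ψ)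
    have h2 := norm_add_le x₀ (∫ τ in (0 : ℝ)..max t 0, G ψ τ)
    have h3 : ‖Φ₀ ψ t‖ = Real.exp (-(l * max t 0)) * ‖x₀ + ∫ τ in (0 : ℝ)..max t 0, G ψ τ‖ := by
      simp only [Φ₀, norm_smul, Real.norm_eq_abs, Real.abs_exp]
    rw [h3]
    calc _ ≤ Real.exp (-(l * max t 0)) *
          (‖x₀‖ + (‖F 0‖ + M + K * ‖ψ‖) / l * Real.exp (l * max t 0)) := by
          gcongr
          exact h2.trans (by gcongr)
      _ = Real.exp (-(l * max t 0)) * ‖x₀‖ + (‖F 0‖ + M + K * ‖ψ‖) / l := by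
          have := hexp t
          linear_combination (‖F 0‖ + M + K * ‖ψ‖) / l * this
      _ ≤ _ := by
          have := mul_le_mul_of_nonneg_right (hexp1 t) (norm_nonneg x₀)
          linarith
  let Φ : BoundedContinuousFunction ℝ E → BoundedContinuousFunction ℝ E := fun ψ =>
    BoundedContinuousFunction.ofNormedAddCommGroup (Φ₀ ψ) (hΦc ψ) _ (hΦb ψ)
  have hΦ : ContractingWith (1 / 2) Φ := by
    refine ⟨by rw [← NNReal.coe_lt_coe]; norm_num, LipschitzWith.of_dist_le_mul fun ψ φ => ?_⟩
    have hD : 0 ≤ dist ψ φ := dist_nonneg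
    refine (BoundedContinuousFunction.dist_le (by positivity)).2 fun t => ?_
    have h0 : ∀ τ, 0 ≤ τ → ‖G ψ τ - G φ τ‖ ≤ (K * dist ψ φ) * Real.exp (l * τ) := by
      intro τ _
      have h2 := hF.dist_le_mul (Real.exp (l * τ) • ψ τ) (Real.exp (l * τ) • φ τ)
      rw [dist_smul₀, Real.norm_eq_abs, Real.abs_exp, dist_eq_norm] at h2
      have h3 : (K : ℝ) * (Real.exp (l * τ) * dist (ψ τ) (φ τ))
          ≤ K * (Real.exp (l * τ) * dist ψ φ) := by
        gcongr
        exact BoundedContinuousFunction.dist_coe_le_dist τ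
      have h4 : G ψ τ - G φ τ =
          F (Real.exp (l * τ) • ψ τ) - F (Real.exp (l * τ) • φ τ) := by simp [G]
      rw [h4]
      linarith
    have h1 := norm_integral_le_exp hlpos (le_max_right t 0) (by positivity) h0
    rw [intervalIntegral.integral_sub (hGint ψ _ _) (hGint φ _ _)] at h1
    have h2 : dist (Φ ψ t) (Φ φ t) = Real.exp (-(l * max t 0)) *
        ‖(∫ τ in (0 : ℝ)..max t 0, G ψ τ) - ∫ τ in (0 : ℝ)..max t 0, G φ τ‖ := by
      simp only [Φ, BoundedContinuousFunction.coe_ofNormedAddCommGroup, Φ₀]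
      rw [dist_smul₀, Real.norm_eq_abs, Real.abs_exp, dist_add_left, dist_eq_norm]
    rw [h2]
    calc _ ≤ Real.exp (-(l * max t 0)) * (K * dist ψ φ / l * Real.exp (l * max t 0)) := by gcongr
      _ = K / l * dist ψ φ := by
          linear_combination (K * dist ψ φ / l) * hexp t
      _ ≤ ((1 / 2 : NNReal) : ℝ) * dist ψ φ := by
          gcongr
          rw [div_le_iff₀ hlpos]
          push_cast
          linarith
  set ψ := hΦ.fixedPoint with hψ
  have hfix : ∀ t, Φ₀ ψ t = ψ t := fun t => by
    have : Φ ψ = ψ := hΦ.fixedPoint_isFixedPt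
    exact DFunLike.congr_fun this t
  have hsol : ∀ t, 0 ≤ t → Real.exp (l * t) • ψ t = x₀ + ∫ τ in (0 : ℝ)..t, G ψ τ := by
    intro t ht
    rw [← hfix t]
    have := hexp t
    simp only [Φ₀, smul_smul, max_eq_left ht] at this ⊢
    rw [mul_comm, this, one_smul]
  have h00 : Real.exp (l * 0) • ψ 0 = x₀ := by simpa using hsol 0 le_rfl
  refine ⟨fun t => Real.exp (l * t) • ψ t, h00, fun t ht => ⟨hGint ψ 0 t, ?_⟩⟩
  simp only [h00]
  exact hsol t ht

theorem forwardComplete_of_lipschitz {F : E → E} {K : NNReal} (hF : LipschitzWith K F) {e : ℝ → E}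
    (hem : AEStronglyMeasurable e volume) (he : ∃ M : ℝ, ∀ t, 0 ≤ t → ‖e t‖ ≤ M) :
    ForwardComplete (fun t x => F x + e t) := by
  obtain ⟨M, hM⟩ := he
  -- the values of the input at negative times are set to zero
  have hex : ∀ x₀ : E, ∃ x : ℝ → E, x 0 = x₀ ∧ IsSolutionOn (fun t x => F x + e t) (Ici 0) x := by
    intro x₀
    have hM0 : 0 ≤ M := (norm_nonneg _).trans (hM 0 le_rfl)
    obtain ⟨x, hx0, hx⟩ := exists_isSolutionOn hF (e := (Ici 0).indicator e)
      (hem.indicator measurableSet_Ici) (M := M) (fun t => by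
        by_cases ht : t ∈ Ici (0 : ℝ)
        · simpa [indicator_of_mem ht] using hM t ht
        · simpa [indicator_of_notMem ht] using hM0) x₀
    refine ⟨x, hx0, fun t ht => ?_⟩
    have heq : ∀ τ ∈ uIcc 0 t, F (x τ) + (Ici 0).indicator e τ = F (x τ) + e τ := by
      intro τ hτ
      rw [uIcc_of_le ht] at hτ
      rw [indicator_of_mem (show τ ∈ Ici (0 : ℝ) from hτ.1)]
    obtain ⟨h1, h2⟩ := hx t ht
    refine ⟨h1.congr (fun τ hτ => heq τ (uIoc_subset_uIcc hτ)), ?_⟩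
    rw [h2, intervalIntegral.integral_congr heq]
  refine ⟨hex, fun T hT x hx => ?_⟩
  obtain ⟨x', hx'0, hx'⟩ := hex (x 0)
  refine ⟨x', hx', IsSolutionOn.eqOn_Ico hF (fun t ht => hx' t ht.1) hx hx'0⟩

end Existence

/-! ### Lyapunov functions along Carathéodory solutions -/

section Lyapunov

variable {E : Type*} [NormedAddCommGroup E] [NormedSpace ℝ E] [CompleteSpace E]

/-- Along a solution of `ẋ = F(x) + e(t)` a differentiable function has an upper right Dini
derivative bounded, at *every* time, by the supremum of its derivative in the directions
`F(x) + v`, where `v` ranges over the ball containing the later values of `e`. -/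
theorem IsSolutionOn.frequently_slope_lt {F : E → E} (hF : Continuous F) {e y : ℝ → E}
    (hy : IsSolutionOn (fun t x => F x + e t) (Ici 0) y) {t δ : ℝ} (ht : 0 ≤ t)
    (he : ∀ τ, t ≤ τ → ‖e τ‖ ≤ δ) {V : E → ℝ} {L : E →L[ℝ] ℝ} (hV : HasFDerivAt V L (y t))
    {m r : ℝ} (hm : ∀ v, ‖v‖ ≤ δ → L (F (y t) + v) ≤ m) (hr : m < r) :
    ∃ᶠ u in 𝓝[>] t, slope (fun τ => V (y τ)) t u < r := by
  apply Eventually.frequently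
  have hyc : ContinuousWithinAt y (Ici t) t :=
    (hy.continuousOn t ht).mono fun s (hs : t ≤ s) => ht.trans hs
  have hFc : ContinuousWithinAt (fun τ => F (y τ)) (Ici t) t :=
    hF.continuousAt.comp_continuousWithinAt hyc
  have hLc : ContinuousWithinAt (fun τ => L (F (y τ))) (Ici t) t :=
    L.continuous.continuousAt.comp_continuousWithinAt hFc
  set ε : ℝ := (r - m) / 3 with hε
  have hεpos : 0 < ε := by rw [hε]; linarith
  have hδ : 0 ≤ δ := (norm_nonneg _).trans (he t le_rfl)
  have hnorm : ∀ᶠ τ in 𝓝[≥] t, ‖F (y τ)‖ < ‖F (y t)‖ + 1 :=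
    hFc.norm.eventually_lt continuousWithinAt_const (by simp)
  have hLev : ∀ᶠ τ in 𝓝[≥] t, L (F (y τ)) < L (F (y t)) + ε :=
    hLc.eventually_lt continuousWithinAt_const (by simpa using hεpos)
  obtain ⟨u₀, hu₀, hsub⟩ := mem_nhdsGE_iff_exists_Ico_subset.1 (hnorm.and hLev)
  -- the increment of the solution is of first order
  have hO : (fun u => y u - y t) =O[𝓝[>] t] fun u => u - t := by
    refine Asymptotics.IsBigO.of_bound (‖F (y t)‖ + 1 + δ) ?_
    filter_upwards [Ioo_mem_nhdsGT hu₀] with u hu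
    rw [(hy.sub_eq ht (ht.trans hu.1.le)).2, Real.norm_eq_abs]
    refine intervalIntegral.norm_integral_le_of_norm_le_const fun τ hτ => ?_
    rw [uIoc_of_le hu.1.le] at hτ
    exact (norm_add_le _ _).trans
      (add_le_add (hsub ⟨hτ.1.le, hτ.2.trans_lt hu.2⟩).1.le (he τ hτ.1.le))
  have hyt : Tendsto y (𝓝[>] t) (𝓝 (y t)) :=
    (hyc.mono Ioi_subset_Ici_self)
  have ho := (hV.isLittleO.comp_tendsto hyt).trans_isBigO hO
  filter_upwards [ho.def hεpos, Ioo_mem_nhdsGT hu₀] with u hu1 hu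
  have hut : 0 < u - t := sub_pos.2 hu.1
  have hint := hy.sub_eq ht (ht.trans hu.1.le)
  have hLint : L (y u - y t) ≤ (m + ε) * (u - t) := by
    rw [hint.2, ← L.intervalIntegral_comp_comm hint.1]
    have h1 : IntervalIntegrable (fun τ => L (F (y τ) + e τ)) volume t u :=
      ⟨L.integrable_comp hint.1.1, L.integrable_comp hint.1.2⟩
    have := intervalIntegral.integral_mono_on_of_le_Ioo hu.1.le h1
      (intervalIntegrable_const (c := m + ε)) (fun τ hτ => by
        have h2 := (hsub ⟨hτ.1.le, hτ.2.trans hu.2⟩).2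
        have h3 := hm (e τ) (he τ hτ.1.le)
        simp only [map_add] at h3 ⊢
        linarith)
    simpa only [intervalIntegral.integral_const, smul_eq_mul, mul_comm] using this
  simp only [Function.comp_def, Real.norm_eq_abs, abs_of_pos hut] at hu1
  have h4 := (abs_le.1 hu1).2
  rw [slope_def_field, div_lt_iff₀ hut]
  have : r = m + 3 * ε := by rw [hε]; ring
  have : 0 < ε * (u - t) := by positivity
  nlinarith

variable {F : E → E} {e y : ℝ → E} {T δ : ℝ} {V : E → ℝ} {V' : E → E →L[ℝ] ℝ}

/-- Comparison of a Lyapunov function with an affine function decreasing at rate `k`. -/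
theorem IsSolutionOn.le_affine (hF : Continuous F)
    (hy : IsSolutionOn (fun t x => F x + e t) (Ici 0) y) (hT : 0 ≤ T)
    (he : ∀ t, T ≤ t → ‖e t‖ ≤ δ) (hV : ∀ x, HasFDerivAt V (V' x) x) {β k m T₁ : ℝ}
    (h0 : V (y T) ≤ β) (hkm : k < m)
    (h : ∀ t, T ≤ t → t < T₁ → V (y t) = β - k * (t - T) →
      ∀ v, ‖v‖ ≤ δ → V' (y t) (F (y t) + v) ≤ -m) :
    ∀ t ∈ Icc T T₁, V (y t) ≤ β - k * (t - T) := by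
  classical
  have hVc : Continuous V := continuous_iff_continuousAt.2 fun x => (hV x).continuousAt
  refine image_le_of_liminf_slope_right_lt_deriv_boundary' (f := fun t => V (y t))
    (f' := fun t => if V (y t) = β - k * (t - T) then -m
      else V' (y t) (F (y t)) + ‖V' (y t)‖ * δ)
    (hVc.comp_continuousOn (hy.continuousOn.mono fun t ht => hT.trans ht.1)) ?_
    (B' := fun _ => -k) (by simpa using h0) (by fun_prop) ?_ ?_
  · intro t ht r hr
    refine hy.frequently_slope_lt hF (hT.trans ht.1) (fun τ hτ => he τ (ht.1.trans hτ))
      (hV (y t)) (fun v hv => ?_) hr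
    split_ifs with hif
    · exact h t ht.1 ht.2 hif v hv
    · rw [map_add]
      gcongr
      exact (le_abs_self _).trans (((V' (y t)).le_opNorm v).trans (by gcongr))
  · intro t _
    have : HasDerivAt (fun t => β - k * (t - T)) (-k) t := by
      simpa using (((hasDerivAt_id t).sub_const T).const_mul k).const_sub β
    exact this.hasDerivWithinAt
  · intro t _ hteq
    simp only [hteq, if_true]
    linarith

/-- A sublevel set of `V` is forward invariant if `V` decreases on its boundary. -/
theorem IsSolutionOn.le_of_decreasing (hF : Continuous F)
    (hy : IsSolutionOn (fun t x => F x + e t) (Ici 0) y) (hT : 0 ≤ T)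
    (he : ∀ t, T ≤ t → ‖e t‖ ≤ δ) (hV : ∀ x, HasFDerivAt V (V' x) x) {c m : ℝ}
    (h0 : V (y T) ≤ c) (hm : 0 < m)
    (h : ∀ t, T ≤ t → V (y t) = c → ∀ v, ‖v‖ ≤ δ → V' (y t) (F (y t) + v) ≤ -m) :
    ∀ t, T ≤ t → V (y t) ≤ c := by
  intro t ht
  have := hy.le_affine hF hT he hV h0 (k := 0) hm (T₁ := t)
    (fun s hs _ hsc => h s hs (by simpa using hsc)) t ⟨ht, le_rfl⟩
  simpa using this

/-- A sublevel set of `V` is reached, and never left again, if outside of it `V` decreases at a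
positive rate. -/
theorem IsSolutionOn.eventually_le (hF : Continuous F)
    (hy : IsSolutionOn (fun t x => F x + e t) (Ici 0) y) (hT : 0 ≤ T)
    (he : ∀ t, T ≤ t → ‖e t‖ ≤ δ) (hV : ∀ x, HasFDerivAt V (V' x) x) {c m : ℝ} (hm : 0 < m)
    (h : ∀ t, T ≤ t → c ≤ V (y t) → ∀ v, ‖v‖ ≤ δ → V' (y t) (F (y t) + v) ≤ -m) :
    ∀ᶠ t in atTop, V (y t) ≤ c := by
  suffices ∃ T₁, T ≤ T₁ ∧ V (y T₁) ≤ c by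
    obtain ⟨T₁, hT₁, hc⟩ := this
    filter_upwards [eventually_ge_atTop T₁] with t ht
    exact hy.le_of_decreasing hF (hT.trans hT₁) (fun t ht => he t (hT₁.trans ht)) hV hc hm
      (fun s hs hsc => h s (hT₁.trans hs) hsc.ge) t ht
  rcases le_or_gt (V (y T)) c with hc | hc
  · exact ⟨T, le_rfl, hc⟩
  set T₁ := T + (V (y T) - c) / (m / 2) with hT₁
  have hpos : 0 ≤ (V (y T) - c) / (m / 2) := by
    have := sub_pos.2 hc
    positivity
  have hTT : T ≤ T₁ := by linarith
  have hval : m / 2 * (T₁ - T) = V (y T) - c := by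
    rw [hT₁, add_sub_cancel_left]
    field_simp
  refine ⟨T₁, hTT, ?_⟩
  have := hy.le_affine hF hT he hV le_rfl (k := m / 2) (m := m) (T₁ := T₁) (by linarith)
    (fun t ht ht1 hteq => h t ht (by
      have : m / 2 * (t - T) ≤ m / 2 * (T₁ - T) := by gcongr
      linarith)) T₁ ⟨hTT, le_rfl⟩
  linarith

end Lyapunov

/-! ### A small-gain argument for eventual bounds -/

section SmallGain

open Finset in
/-- The step of the small-gain iteration. Blocks `0, …, j - 1` only enter through saturated terms;
from bounds on the blocks above `j` one obtains bounds on the blocks `j, …, n - 1`, in which the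
previous bound `B` is multiplied by the small factor `τ`. -/
theorem eventually_le_of_gain_step {n : ℕ} {N : ℕ → ℝ → ℝ} {P : ℕ → ℝ} {K δ₀ η τ B : ℝ} {j : ℕ}
    (hN : ∀ m t, 0 ≤ N m t) (hP : ∀ m < n, 0 < P m) (hanti : ∀ m < n, j ≤ m → P m ≤ P j)
    (hK : 1 ≤ K) (hη : 0 < η) (hτ0 : 0 ≤ τ) (hB : 0 ≤ B) (hτ : τ ≤ 1)
    (hgain : ∀ k < n, ∀ g, 0 < g → g ≤ δ₀ →
      (∀ᶠ t in atTop, ∑ l ∈ Ico (k + 1) n, N l t ^ 2 ≤ 1) →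
      (∀ᶠ t in atTop, P k * (∑ m ∈ range k, min 1 (N m t) / P m
        + ∑ m ∈ Ico (k + 1) n, (∑ l ∈ Ico m n, N l t ^ 2) * (N m t / P m) + η) ≤ g) →
      ∀ᶠ t in atTop, N k t ≤ K * g)
    (htail : ∀ᶠ t in atTop, ∀ m, j < m → ∑ l ∈ Ico m n, N l t ^ 2 ≤ τ)
    (hbd : ∀ᶠ t in atTop, ∀ m < n, j < m → N m t ≤ P m * B)
    (hδ : P j * ((1 + K) ^ n * (∑ m ∈ range j, 1 / P m + η + n * τ * B)) ≤ δ₀) :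
    ∀ᶠ t in atTop, ∀ m < n, j ≤ m →
      N m t ≤ P m * ((1 + K) ^ n * (∑ m ∈ range j, 1 / P m + η + n * τ * B)) := by
  set c := ∑ m ∈ range j, 1 / P m + η + n * τ * B with hc
  rcases le_or_gt n j with hnj | hjn
  · exact Eventually.of_forall fun t m hm hjm => absurd (hjm.trans_lt hm) (not_lt.2 hnj)
  have hPj := hP j hjn
  have hsum0 : 0 ≤ ∑ m ∈ range j, 1 / P m :=
    Finset.sum_nonneg fun m hm => by
      have := hP m ((Finset.mem_range.1 hm).trans hjn)
      positivity
  have hc0 : 0 < c := by positivity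
  have hL : 1 ≤ 1 + K := by linarith
  -- the bounds for the blocks from `j` on are obtained one after the other
  have key : ∀ q, j + q ≤ n →
      ∀ᶠ t in atTop, ∀ i < q, N (j + i) t ≤ P (j + i) * ((1 + K) ^ (i + 1) * c) := by
    intro q
    induction q with
    | zero => intro _; simp
    | succ q ih =>
      intro hq
      have hk : j + q < n := by omega
      have hPk := hP (j + q) hk
      have hgeom : ∀ q : ℕ, K * (1 + ∑ i ∈ range q, (1 + K) ^ (i + 1)) ≤ (1 + K) ^ (q + 1) := by
        intro q
        induction q with
        | zero => simp
        | succ q ihq =>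
          rw [Finset.sum_range_succ]
          have : (1 + K) ^ (q + 1 + 1) = (1 + K) ^ (q + 1) + K * (1 + K) ^ (q + 1) := by ring
          linarith
      set G := 1 + ∑ i ∈ range q, (1 + K) ^ (i + 1) with hG
      have hGpos : 0 < G := by positivity
      have hgK : K * (P (j + q) * (G * c)) ≤ P (j + q) * ((1 + K) ^ (q + 1) * c) := by
        have := mul_le_mul_of_nonneg_right (hgeom q) (mul_pos hPk hc0).le
        linarith
      have hgδ : P (j + q) * (G * c) ≤ δ₀ := by
        calc P (j + q) * (G * c) ≤ K * (P (j + q) * (G * c)) :=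
              le_mul_of_one_le_left (by positivity) hK
          _ ≤ P (j + q) * ((1 + K) ^ (q + 1) * c) := hgK
          _ ≤ P j * ((1 + K) ^ n * c) := by
              gcongr
              · exact hanti _ hk (by omega)
              omega
          _ ≤ δ₀ := hδ
      have hnew := hgain (j + q) hk (P (j + q) * (G * c)) (by positivity) hgδ
        (by filter_upwards [htail] with t ht using (ht _ (by omega)).trans hτ)
        (by
          filter_upwards [htail, hbd, ih (by omega)] with t ht1 ht2 ht3
          refine mul_le_mul_of_nonneg_left ?_ hPk.le
          have e1 : ∑ m ∈ range (j + q), min 1 (N m t) / P m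
              ≤ ∑ m ∈ range j, 1 / P m + ∑ i ∈ range q, (1 + K) ^ (i + 1) * c := by
            rw [Finset.sum_range_add]
            refine add_le_add (Finset.sum_le_sum fun m hm => ?_) (Finset.sum_le_sum fun i hi => ?_)
            · have := hP m ((Finset.mem_range.1 hm).trans hjn)
              gcongr
              exact min_le_left _ _
            · have hi' := Finset.mem_range.1 hi
              have := hP (j + i) (by omega)
              rw [div_le_iff₀ this, mul_comm]
              exact (min_le_right _ _).trans (ht3 i hi')
          have e2 : ∑ m ∈ Ico (j + q + 1) n, (∑ l ∈ Ico m n, N l t ^ 2) * (N m t / P m)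
              ≤ n * τ * B := by
            calc _ ≤ ∑ m ∈ Ico (j + q + 1) n, τ * B := by
                  refine Finset.sum_le_sum fun m hm => ?_
                  have hm' := Finset.mem_Ico.1 hm
                  have := hP m hm'.2
                  refine mul_le_mul (ht1 m (by omega)) ?_ ?_ hτ0
                  · rw [div_le_iff₀ this, mul_comm]
                    exact ht2 m hm'.2 (by omega)
                  · exact div_nonneg (hN m t) this.le
              _ ≤ n * (τ * B) := by
                  rw [Finset.sum_const, nsmul_eq_mul, Nat.card_Ico]
                  gcongr
                  omega
              _ = n * τ * B := by ring
          rw [← Finset.sum_mul] at e1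
          have e3 : G * c = c + (∑ i ∈ range q, (1 + K) ^ (i + 1)) * c := by rw [hG]; ring
          rw [e3]
          linarith)
      filter_upwards [hnew, ih (by omega)] with t h1 h2 i hi
      rcases Nat.lt_succ_iff_lt_or_eq.1 hi with hi | rfl
      · exact h2 i hi
      · exact h1.trans hgK
  filter_upwards [key (n - j) (by omega)] with t ht m hm hjm
  obtain ⟨i, rfl⟩ := Nat.exists_eq_add_of_le hjm
  refine (ht i (by omega)).trans ?_
  have := hP _ hm
  gcongr
  omega

open Finset in
/-- Eventual bounds for a cascade of `n` blocks. Block `k` has asymptotic gain `K` from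
disturbances that are small enough; its disturbance consists of the saturated contributions of the
blocks below it, of the contributions of the blocks above it, which carry a factor quadratic in the
latter, and of `η`. If the weights `P` decrease fast enough, all blocks become proportional to
`η`. -/
theorem eventually_le_of_gain {n : ℕ} {N : ℕ → ℝ → ℝ} {P : ℕ → ℝ} {K δ₀ η ε : ℝ}
    (hN : ∀ m t, 0 ≤ N m t) (hP : ∀ m < n, 0 < P m) (hP0 : P 0 ≤ 1)
    (hPε : ∀ m, m + 1 < n → P (m + 1) ≤ ε * P m)
    (hK : 1 ≤ K) (hη : 0 < η) (hηε : η ≤ ε) (hε : ε ≤ 1 / 2)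
    (hτ1 : n * (9 * (1 + K) ^ n * ε) ^ 2 ≤ 1)
    (hτ2 : (1 + K) ^ n * (n * (n * (9 * (1 + K) ^ n * ε) ^ 2)) ≤ 1 / 3)
    (hτ3 : (1 + K) ^ n * (3 * ε + 10 * (1 + K) ^ n * (n * (n * (9 * (1 + K) ^ n * ε) ^ 2))) ≤ δ₀)
    (hgain : ∀ k < n, ∀ g, 0 < g → g ≤ δ₀ →
      (∀ᶠ t in atTop, ∑ l ∈ Ico (k + 1) n, N l t ^ 2 ≤ 1) →
      (∀ᶠ t in atTop, P k * (∑ m ∈ range k, min 1 (N m t) / P m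
        + ∑ m ∈ Ico (k + 1) n, (∑ l ∈ Ico m n, N l t ^ 2) * (N m t / P m) + η) ≤ g) →
      ∀ᶠ t in atTop, N k t ≤ K * g) :
    ∀ᶠ t in atTop, ∀ m < n, N m t ≤ P m * (3 * (1 + K) ^ n * η) := by
  set M := (1 + K) ^ n with hM
  have hM1 : 1 ≤ M := one_le_pow₀ (by linarith)
  set ν := 9 * M * ε with hν
  set τ := n * ν ^ 2 with hτ
  have hτ0 : 0 ≤ τ := by positivity
  have hε0 : 0 < ε := hη.trans_le hηε
  set H : ℕ → ℝ := fun j => ∑ m ∈ range j, 1 / P m with hH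
  have hanti1 : ∀ m, m + 1 < n → P (m + 1) ≤ P m := fun m hm =>
    (hPε m hm).trans (mul_le_of_le_one_left (hP m (by omega)).le (by linarith))
  have hanti : ∀ j m, m < n → j ≤ m → P m ≤ P j := by
    intro j m hm hjm
    induction m, hjm using Nat.le_induction with
    | base => exact le_rfl
    | succ m hjm ih => exact (hanti1 m hm).trans (ih (by omega))
  have hPle1 : ∀ m < n, P m ≤ 1 := fun m hm => (hanti 0 m hm (by omega)).trans hP0
  have hH0 : ∀ j ≤ n, 0 ≤ H j := fun j hj => Finset.sum_nonneg fun m hm => by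
    have := hP m ((Finset.mem_range.1 hm).trans_le hj)
    positivity
  -- the contributions of the saturated blocks are geometrically decreasing
  have hPH : ∀ j < n, P j * H j ≤ 2 * ε := by
    intro j
    induction j with
    | zero => intro _; simpa [H] using hε0.le
    | succ j ih =>
      intro hj
      have h1 := ih (by omega)
      have hPj := hP j (by omega)
      have h2 : P (j + 1) * H (j + 1) ≤ ε * P j * (H j + 1 / P j) := by
        simp only [hH, Finset.sum_range_succ]
        have := hH0 j (by omega)
        have h3 : 0 ≤ H j + 1 / P j := by positivity
        exact mul_le_mul_of_nonneg_right (hPε j hj) h3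
      have h3 : ε * P j * (H j + 1 / P j) = ε * (P j * H j + 1) := by field_simp
      nlinarith
  suffices hC : ∀ j ≤ n, ∀ᶠ t in atTop, ∀ m < n, j ≤ m → N m t ≤ P m * (3 * M * (H j + η)) by
    filter_upwards [hC 0 (Nat.zero_le n)] with t ht m hm
    simpa [H] using ht m hm (Nat.zero_le m)
  intro j hj
  induction hj using Nat.decreasingInduction with
  | self => exact Eventually.of_forall fun t m hm hnm => absurd hm (not_lt.2 hnm)
  | of_succ j hj ih =>
  have hPj := hP j hj
  have hPjη : P j * η ≤ ε :=
    (mul_le_of_le_one_left hη.le (hPle1 j hj)).trans hηε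
  have hPjH := hPH j hj
  have hHj := hH0 j hj.le
  have hHj1 := hH0 (j + 1) hj
  set c := H j + η with hc
  have hc0 : 0 < c := by positivity
  have hPc : P j * c ≤ 3 * ε := by rw [hc, mul_add]; linarith
  have htail : ∀ᶠ t in atTop, ∀ m, j < m → ∑ l ∈ Ico m n, N l t ^ 2 ≤ τ := by
    filter_upwards [ih] with t ht m hm
    calc _ ≤ ∑ l ∈ Ico m n, ν ^ 2 := by
          refine Finset.sum_le_sum fun l hl => ?_
          have hl' := Finset.mem_Ico.1 hl
          have hj1 : j + 1 < n := by omega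
          have h1 := ht l hl'.2 (by omega)
          have h2 : P l * (3 * M * (H (j + 1) + η)) ≤ P (j + 1) * (3 * M * (H (j + 1) + η)) := by
            gcongr
            exact hanti _ _ hl'.2 (by omega)
          have h3 := hPH (j + 1) hj1
          have h4 : P (j + 1) * η ≤ ε :=
            (mul_le_of_le_one_left hη.le (hPle1 _ hj1)).trans hηε
          have h5 : P (j + 1) * (3 * M * (H (j + 1) + η)) ≤ 3 * M * (3 * ε) := by
            have : P (j + 1) * (3 * M * (H (j + 1) + η))
              = 3 * M * (P (j + 1) * H (j + 1) + P (j + 1) * η) := by ring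
            rw [this]
            gcongr
            linarith
          have h6 : N l t ≤ ν := by rw [hν]; linarith
          have := hN l t
          gcongr
      _ ≤ n * ν ^ 2 := by
          rw [Finset.sum_const, nsmul_eq_mul, Nat.card_Ico]
          gcongr
          omega
  set B₀ := 3 * M * (H (j + 1) + η) with hB₀
  have hPB₀ : P j * B₀ ≤ 15 / 2 * M := by
    have h1 : P j * B₀ = 3 * M * (P j * H j + 1 + P j * η) := by
      rw [hB₀]
      simp only [hH, Finset.sum_range_succ]
      field_simp
    rw [h1]
    nlinarith
  have hstep : ∀ B, 0 ≤ B → P j * B ≤ 10 * M →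
      (∀ᶠ t in atTop, ∀ m < n, j < m → N m t ≤ P m * B) →
      ∀ᶠ t in atTop, ∀ m < n, j ≤ m → N m t ≤ P m * (M * c + B / 3) := by
    intro B hB hPB hbd
    have hδ : P j * (M * (c + n * τ * B)) ≤ δ₀ := by
      refine le_trans ?_ hτ3
      have h1 : P j * (M * (c + n * τ * B)) = M * (P j * c + (P j * B) * (n * τ)) := by ring
      rw [h1]
      have h2 : (P j * B) * (n * τ) ≤ 10 * M * (n * τ) := by gcongr
      gcongr
    filter_upwards [eventually_le_of_gain_step hN hP (hanti j) hK hη hτ0 hB hτ1 hgain htail hbd hδ]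
      with t ht m hm hjm
    refine (ht m hm hjm).trans ?_
    have := hP m hm
    gcongr
    have : M * (n * τ) * B ≤ 1 / 3 * B := by gcongr
    change M * (c + n * τ * B) ≤ _
    linarith
  -- iterating the step, the bound converges to `3 / 2 * (M * c)`
  have hiter : ∀ q : ℕ, ∀ᶠ t in atTop, ∀ m < n, j < m →
      N m t ≤ P m * (3 / 2 * (M * c) + B₀ / 3 ^ q) := by
    intro q
    induction q with
    | zero =>
      filter_upwards [ih] with t ht m hm hjm
      refine (ht m hm hjm).trans ?_
      have := hP m hm
      gcongr
      simp only [pow_zero, div_one]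
      have : 0 < M * c := by positivity
      linarith
    | succ q ihq =>
      have hB0 : 0 ≤ B₀ := by positivity
      have := hstep _ (by positivity) ?_ ihq
      · filter_upwards [this] with t ht m hm hjm
        refine (ht m hm hjm.le).trans (le_of_eq ?_)
        ring
      · have h1 : B₀ / 3 ^ q ≤ B₀ := div_le_self hB0 (one_le_pow₀ (by norm_num))
        have h2 : P j * (3 / 2 * (M * c) + B₀ / 3 ^ q) ≤ 3 / 2 * M * (P j * c) + P j * B₀ := by
          have := mul_le_mul_of_nonneg_left h1 hPj.le
          linarith
        nlinarith
  have hlim : Tendsto (fun q : ℕ => B₀ / 3 ^ q) atTop (𝓝 0) := by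
    have := (tendsto_pow_atTop_nhds_zero_of_lt_one (r := (1 / 3 : ℝ)) (by norm_num)
      (by norm_num)).const_mul B₀
    simpa [div_eq_mul_inv] using this
  obtain ⟨q, hq⟩ := (hlim.eventually_lt_const (show 0 < 3 / 2 * (M * c) by positivity)).exists
  have hfin := hstep (3 * (M * c)) (by positivity) (by nlinarith) (by
    filter_upwards [hiter q] with t ht m hm hjm
    refine (ht m hm hjm).trans ?_
    have := hP m hm
    gcongr
    linarith)
  filter_upwards [hfin] with t ht m hm hjm
  refine (ht m hm hjm).trans ?_
  have := hP m hm
  gcongr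
  have : 0 < M * c := by positivity
  linarith

end SmallGain

/-- The smallness conditions of `eventually_le_of_gain` can be met: they hold for `ε → 0`. -/
theorem exists_small (n : ℕ) (K : ℝ) {δ₀ : ℝ} (hδ₀ : 0 < δ₀) : ∃ ε : ℝ, 0 < ε ∧ ε ≤ 1 / 2 ∧
    n * (9 * (1 + K) ^ n * ε) ^ 2 ≤ 1 ∧
    (1 + K) ^ n * (n * (n * (9 * (1 + K) ^ n * ε) ^ 2)) ≤ 1 / 3 ∧
    (1 + K) ^ n * (3 * ε + 10 * (1 + K) ^ n * (n * (n * (9 * (1 + K) ^ n * ε) ^ 2))) ≤ δ₀ := by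
  have hlt : ∀ (f : ℝ → ℝ) (b : ℝ), Continuous f → f 0 < b → ∀ᶠ ε in 𝓝[>] 0, f ε < b :=
    fun f b hf h => (hf.continuousAt.eventually_lt continuousAt_const h).filter_mono
      nhdsWithin_le_nhds
  have h1 := hlt (fun ε => ε) (1 / 2) (by fun_prop) (by norm_num)
  have h2 := hlt (fun ε => n * (9 * (1 + K) ^ n * ε) ^ 2) 1 (by fun_prop) (by norm_num)
  have h3 := hlt (fun ε => (1 + K) ^ n * (n * (n * (9 * (1 + K) ^ n * ε) ^ 2))) (1 / 3)
    (by fun_prop) (by norm_num)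
  have h4 := hlt (fun ε => (1 + K) ^ n * (3 * ε + 10 * (1 + K) ^ n *
    (n * (n * (9 * (1 + K) ^ n * ε) ^ 2)))) δ₀ (by fun_prop) (by simpa using hδ₀)
  obtain ⟨ε, ⟨⟨⟨⟨h1, h2⟩, h3⟩, h4⟩, h0⟩⟩ :=
    ((((h1.and h2).and h3).and h4).and self_mem_nhdsWithin).exists
  exact ⟨ε, h0, h1.le, h2.le, h3.le, h4.le⟩

/-! ### Block coordinates -/

section Blocks

variable {s z : ℕ}

/-- The first coordinate of block `k` (numbered from `0`). An integrator is regarded as an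
oscillator with frequency `0` and first coordinate `0`. -/
def blockPos (k : ℕ) : State s z →L[ℝ] ℝ :=
  if h : k < s then EuclideanSpace.proj (Sum.inl (⟨k, h⟩, 0)) else 0

/-- The output coordinate of block `k` (numbered from `0`): `b₀ᵀ y` for an oscillator, the state
itself for an integrator, and `0` beyond the last block. -/
def blockOut (k : ℕ) : State s z →L[ℝ] ℝ :=
  if h : k < s then EuclideanSpace.proj (Sum.inl (⟨k, h⟩, 1))
  else if h' : k - s < z then EuclideanSpace.proj (Sum.inr ⟨k - s, h'⟩) else 0

/-- The frequency of block `k` (numbered from `0`), which is `0` for an integrator. -/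
def blockFreq (ω : Fin s → ℝ) (k : ℕ) : ℝ := if h : k < s then ω ⟨k, h⟩ else 0

/-- The squared Euclidean norm of block `k`. -/
def blockSq (k : ℕ) (y : State s z) : ℝ := blockPos k y ^ 2 + blockOut k y ^ 2

/-- The sum of the squared norms of the blocks from `k` on. -/
def tailSq (k : ℕ) (y : State s z) : ℝ := ∑ m ∈ Finset.Ico k (s + z), blockSq m y

/-- The saturation factor multiplying the output of block `k` in the feedback law. -/
def satFactor (k : ℕ) (y : State s z) : ℝ := 1 / Real.sqrt (1 + tailSq k y)

/-- The product of the first `k` constants `a 1, …, a k`. All coefficients of the system and of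
the feedback law are quotients of such products. -/
def weight (a : ℕ → ℝ) (k : ℕ) : ℝ := ∏ l ∈ Finset.range k, a (l + 1)

theorem blockPos_osc (j : Fin s) (y : State s z) : blockPos (j : ℕ) y = y (Sum.inl (j, 0)) := by
  simp [blockPos]

theorem blockOut_osc (j : Fin s) (y : State s z) : blockOut (j : ℕ) y = y (Sum.inl (j, 1)) := by
  simp [blockOut]

theorem blockPos_int (j : ℕ) (y : State s z) : blockPos (s + j) y = 0 := by
  simp [blockPos]

theorem blockOut_int (j : Fin z) (y : State s z) : blockOut (s + (j : ℕ)) y = y (Sum.inr j) := by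
  simp [blockOut]

theorem blockFreq_osc (ω : Fin s → ℝ) (j : Fin s) : blockFreq ω (j : ℕ) = ω j := by
  simp [blockFreq]

theorem blockFreq_int (ω : Fin s → ℝ) (j : ℕ) : blockFreq ω (s + j) = 0 := by
  simp [blockFreq]

/-- For nonzero frequencies, the blocks of frequency `0` are the integrators. -/
theorem blockPos_eq_zero {ω : Fin s → ℝ} (hω : ∀ j, ω j ≠ 0) {k : ℕ} (hk : blockFreq ω k = 0)
    (y : State s z) : blockPos k y = 0 := by
  by_cases h : k < s
  · simp [blockFreq, h, hω] at hk
  · simp [blockPos, h]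

theorem blockSq_nonneg (k : ℕ) (y : State s z) : 0 ≤ blockSq k y := by
  unfold blockSq; positivity

theorem tailSq_nonneg (k : ℕ) (y : State s z) : 0 ≤ tailSq k y :=
  Finset.sum_nonneg fun _ _ => blockSq_nonneg _ _

theorem sum_Ico_blocks (f : ℕ → ℝ) (k : ℕ) :
    ∑ m ∈ Finset.Ico k (s + z), f m =
      ∑ j : Fin s, (if k ≤ (j : ℕ) then f j else 0)
        + ∑ j : Fin z, (if k ≤ s + (j : ℕ) then f (s + j) else 0) := by
  have h : Finset.Ico k (s + z) = (Finset.range (s + z)).filter (k ≤ ·) := by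
    ext m; simp [and_comm]
  rw [h, Finset.sum_filter, Finset.sum_range_add, Finset.sum_range, Finset.sum_range]

theorem norm_sq_eq_sum_blockSq (y : State s z) :
    ‖y‖ ^ 2 = ∑ m ∈ Finset.range (s + z), blockSq m y := by
  rw [EuclideanSpace.norm_sq_eq, Fintype.sum_sum_type, Fintype.sum_prod_type, Finset.sum_range_add,
    Finset.sum_range, Finset.sum_range]
  simp [blockSq, blockPos_osc, blockOut_osc, blockPos_int, blockOut_int]

theorem blockSq_le_norm_sq (k : ℕ) (y : State s z) : blockSq k y ≤ ‖y‖ ^ 2 := by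
  by_cases hk : k < s + z
  · rw [norm_sq_eq_sum_blockSq]
    exact Finset.single_le_sum (f := fun m => blockSq m y) (fun m _ => blockSq_nonneg m y)
      (Finset.mem_range.2 hk)
  · have h1 : ¬ k < s := by omega
    have h2 : ¬ k - s < z := by omega
    simp [blockSq, blockPos, blockOut, h1, h2]

theorem abs_blockOut_le_norm (k : ℕ) (y : State s z) : |blockOut k y| ≤ ‖y‖ := by
  refine abs_le_of_sq_le_sq ?_ (norm_nonneg y)
  have := blockSq_le_norm_sq k y
  unfold blockSq at this
  nlinarith [sq_nonneg (blockPos k y)]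

theorem abs_blockPos_le_norm (k : ℕ) (y : State s z) : |blockPos k y| ≤ ‖y‖ := by
  refine abs_le_of_sq_le_sq ?_ (norm_nonneg y)
  have := blockSq_le_norm_sq k y
  unfold blockSq at this
  nlinarith [sq_nonneg (blockOut k y)]

theorem state_ext {x y : State s z} (h1 : ∀ k < s + z, blockPos k x = blockPos k y)
    (h2 : ∀ k < s + z, blockOut k x = blockOut k y) : x = y := by
  have h : ‖x - y‖ ^ 2 = 0 := by
    rw [norm_sq_eq_sum_blockSq]
    refine Finset.sum_eq_zero fun m hm => ?_
    have hm := Finset.mem_range.1 hm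
    simp [blockSq, h1 m hm, h2 m hm]
  exact sub_eq_zero.1 (norm_eq_zero.1 (pow_eq_zero_iff (by norm_num) |>.1 h))

theorem one_le_sqrt_one_add_tailSq (k : ℕ) (y : State s z) : 1 ≤ Real.sqrt (1 + tailSq k y) := by
  rw [Real.one_le_sqrt]
  linarith [tailSq_nonneg k y]

theorem satFactor_pos (k : ℕ) (y : State s z) : 0 < satFactor k y := by
  have := one_le_sqrt_one_add_tailSq k y
  unfold satFactor
  positivity

theorem satFactor_le_one (k : ℕ) (y : State s z) : satFactor k y ≤ 1 := by
  have := one_le_sqrt_one_add_tailSq k y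
  unfold satFactor
  rw [div_le_one (by positivity)]
  exact this

theorem one_sub_satFactor_le (k : ℕ) (y : State s z) : 1 - satFactor k y ≤ tailSq k y := by
  have h1 := one_le_sqrt_one_add_tailSq k y
  have h2 : Real.sqrt (1 + tailSq k y) ^ 2 = 1 + tailSq k y :=
    Real.sq_sqrt (by linarith [tailSq_nonneg k y])
  unfold satFactor
  rw [sub_le_iff_le_add, ← sub_le_iff_le_add', le_div_iff₀ (by positivity)]
  nlinarith

theorem blockSq_le_tailSq {k : ℕ} (hk : k < s + z) (y : State s z) : blockSq k y ≤ tailSq k y :=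
  Finset.single_le_sum (f := fun m => blockSq m y) (fun m _ => blockSq_nonneg m y)
    (Finset.mem_Ico.2 ⟨le_rfl, hk⟩)

theorem tailSq_eq {k : ℕ} (hk : k < s + z) (y : State s z) :
    tailSq k y = blockSq k y + tailSq (k + 1) y :=
  Finset.sum_eq_sum_Ico_succ_bot hk _

/-- The saturated output of a block is bounded by `1` and by the norm of the block. -/
theorem satFactor_mul_abs_le {k : ℕ} (hk : k < s + z) (y : State s z) :
    satFactor k y * |blockOut k y| ≤ min 1 (Real.sqrt (blockSq k y)) := by
  have h0 : |blockOut k y| ≤ Real.sqrt (blockSq k y) := by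
    apply Real.abs_le_sqrt
    unfold blockSq
    nlinarith [sq_nonneg (blockPos k y)]
  have h1 := one_le_sqrt_one_add_tailSq k y
  refine le_min ?_ ?_
  · unfold satFactor
    rw [one_div, inv_mul_le_iff₀ (by positivity), mul_one]
    exact h0.trans (Real.sqrt_le_sqrt (by linarith [blockSq_le_tailSq hk y]))
  · exact (mul_le_of_le_one_left (abs_nonneg _) (satFactor_le_one k y)).trans h0

theorem tailOsc_eq (y : State s z) (j : Fin s) : tailOsc y j = tailSq (j : ℕ) y := by
  unfold tailOsc tailSq
  rw [sum_Ico_blocks, Finset.sum_filter]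
  congr 1
  · refine Finset.sum_congr rfl fun m _ => ?_
    simp [osc, blockSq, blockPos_osc, blockOut_osc]
  · refine Finset.sum_congr rfl fun m _ => ?_
    have : (j : ℕ) ≤ s + m := j.2.le.trans (Nat.le_add_right _ _)
    simp [int, blockSq, blockPos_int, blockOut_int, this]

theorem tailInt_eq (y : State s z) (j : Fin z) : tailInt y j = tailSq (s + (j : ℕ)) y := by
  unfold tailInt tailSq
  have hj : ∀ m : Fin s, ¬ s + (j : ℕ) ≤ m := fun m => by omega
  rw [sum_Ico_blocks, Finset.sum_filter]
  simp [hj, int, blockSq, blockPos_int, blockOut_int]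

variable {a : ℕ → ℝ}

theorem weight_succ (a : ℕ → ℝ) (k : ℕ) : weight a (k + 1) = weight a k * a (k + 1) :=
  Finset.prod_range_succ _ _

theorem weight_pos {n : ℕ} (ha : ∀ i, 1 ≤ i → i ≤ n → 0 < a i) {k : ℕ} (hk : k ≤ n) :
    0 < weight a k :=
  Finset.prod_pos fun l hl => ha _ (by omega) (by have := Finset.mem_range.1 hl; omega)

theorem theta_eq {n : ℕ} (ha : ∀ i, 1 ≤ i → i ≤ n → 0 < a i) {k m : ℕ} (hkm : k < m)
    (hm : m ≤ n) : theta a (k + 1) (m + 1) = weight a (k + 1) / weight a m := by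
  have hp := weight_pos ha (k := k + 1) (by omega)
  have hp' := weight_pos ha hm
  unfold theta
  split_ifs with h
  · have : m = k + 1 := by omega
    subst this
    exact (div_self hp.ne').symm
  · have h1 : Finset.Icc (k + 1) (m + 1 - 2) = Finset.Ico (k + 1) m := by
      ext l; simp only [Finset.mem_Icc, Finset.mem_Ico]; omega
    have h2 : weight a (k + 1) * ∏ h ∈ Finset.Ico (k + 1) m, a (h + 1) = weight a m :=
      Finset.prod_range_mul_prod_Ico _ (by omega)
    rw [h1, Finset.prod_div_distrib, Finset.prod_const_one, ← h2]
    rw [← h2] at hp'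
    have := (pos_of_mul_pos_right hp' hp.le).ne'
    field_simp

theorem gain_eq {n : ℕ} (ha : ∀ i, 1 ≤ i → i ≤ n → 0 < a i) {k : ℕ} (hk : k ≤ n) :
    gain a (k + 1) n = weight a n / weight a k := by
  have hp := weight_pos ha hk
  rw [eq_div_iff hp.ne', mul_comm]
  have h2 : weight a k * ∏ h ∈ Finset.Ico k n, a (h + 1) = weight a n :=
    Finset.prod_range_mul_prod_Ico _ hk
  rw [← h2, Finset.prod_Ico_add']
  congr 1

theorem b₀_dotProduct (v : Fin 2 → ℝ) : b₀ ⬝ᵥ v = v 1 := by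
  simp [b₀, dotProduct, Fin.sum_univ_two]

theorem kappa_eq (ha : ∀ i, 1 ≤ i → i ≤ s + z → 0 < a i) (y : State s z) :
    kappa a y = -∑ m ∈ Finset.range (s + z),
      weight a (s + z) / weight a m * (satFactor m y * blockOut m y) := by
  rw [Finset.sum_range_add, neg_add, ← sub_eq_add_neg, Finset.sum_range, Finset.sum_range]
  unfold kappa
  congr 1
  · congr 1
    refine Finset.sum_congr rfl fun j _ => ?_
    rw [gain_eq ha (by omega), tailOsc_eq, blockOut_osc, satFactor, b₀_dotProduct, osc]
    ring
  · refine Finset.sum_congr rfl fun j _ => ?_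
    rw [gain_eq ha (by omega), tailInt_eq, blockOut_int, satFactor, int]
    ring

theorem blockPos_triSystem (ω : Fin s → ℝ) (a : ℕ → ℝ) (y : State s z) (u : ℝ) (k : ℕ) :
    blockPos k (triSystem ω a y u) = blockFreq ω k * blockOut k y := by
  by_cases h : k < s
  · have hp := blockPos_osc (z := z) ⟨k, h⟩ (triSystem ω a y u)
    have ho := blockOut_osc (z := z) ⟨k, h⟩ y
    have hf := blockFreq_osc ω ⟨k, h⟩
    simp only at hp ho hf
    rw [hp, ho, hf]
    simp [triSystem, A₀, b₀, osc, dotProduct, Fin.sum_univ_two]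
  · simp [blockPos, blockFreq, h]

theorem blockOut_triSystem (ω : Fin s → ℝ) (ha : ∀ i, 1 ≤ i → i ≤ s + z → 0 < a i)
    (y : State s z) (u : ℝ) {k : ℕ} (hk : k < s + z) :
    blockOut k (triSystem ω a y u) = -blockFreq ω k * blockPos k y
      + ∑ m ∈ Finset.Ico (k + 1) (s + z), weight a (k + 1) / weight a m * blockOut m y
      + weight a (k + 1) / weight a (s + z) * u := by
  have hsum : ∑ m ∈ Finset.Ico (k + 1) (s + z), weight a (k + 1) / weight a m * blockOut m y
      = ∑ m ∈ Finset.Ico (k + 1) (s + z), theta a (k + 1) (m + 1) * blockOut m y :=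
    Finset.sum_congr rfl fun m hm => by
      have := Finset.mem_Ico.1 hm
      rw [theta_eq ha (by omega) this.2.le]
  rw [hsum, sum_Ico_blocks, ← theta_eq ha hk le_rfl]
  by_cases h : k < s
  · lift k to Fin s using h
    rw [blockOut_osc, blockFreq_osc, blockPos_osc]
    have hk' : ∀ j : ℕ, (k : ℕ) + 1 ≤ s + j := fun j => by omega
    simp [triSystem, A₀, b₀, osc, int, dotProduct, Fin.sum_univ_two, hk',
      blockOut_osc, blockOut_int, Finset.sum_filter]
    ring
  · obtain ⟨j, rfl⟩ := Nat.exists_eq_add_of_le (not_lt.1 h)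
    have hj : j < z := by omega
    lift j to Fin z using hj
    rw [blockOut_int, blockFreq_int]
    have hk' : ∀ i : Fin s, ¬ s + (j : ℕ) + 1 ≤ i := fun i => by omega
    simp [triSystem, int, hk', blockOut_int, Finset.sum_filter]

theorem blockPos_closedLoop (ω : Fin s → ℝ) (a : ℕ → ℝ) (y : State s z) (k : ℕ) :
    blockPos k (closedLoop (triSystem ω a) (kappa a) y) = blockFreq ω k * blockOut k y :=
  blockPos_triSystem ω a y _ k

/-- In the closed loop the blocks above `k` act on block `k` only through the defect `1 - σ` of
the saturation, which vanishes to second order: the linear coupling terms cancel. -/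
theorem blockOut_closedLoop (ω : Fin s → ℝ) (ha : ∀ i, 1 ≤ i → i ≤ s + z → 0 < a i)
    (y : State s z) {k : ℕ} (hk : k < s + z) :
    blockOut k (closedLoop (triSystem ω a) (kappa a) y) = -blockFreq ω k * blockPos k y
      + weight a (k + 1) *
        (∑ m ∈ Finset.Ico (k + 1) (s + z), (1 - satFactor m y) * (blockOut m y / weight a m)
          - ∑ m ∈ Finset.range (k + 1), satFactor m y * (blockOut m y / weight a m)) := by
  have hn := (weight_pos ha (le_refl (s + z))).ne'
  unfold closedLoop
  rw [blockOut_triSystem ω ha _ _ hk, kappa_eq ha, add_assoc]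
  congr 1
  have h1 : weight a (k + 1) / weight a (s + z) * -∑ m ∈ Finset.range (s + z),
      weight a (s + z) / weight a m * (satFactor m y * blockOut m y)
      = -(weight a (k + 1) * ∑ m ∈ Finset.range (s + z),
        satFactor m y * (blockOut m y / weight a m)) := by
    rw [mul_neg, Finset.mul_sum, Finset.mul_sum]
    congr 1
    refine Finset.sum_congr rfl fun m hm => ?_
    field_simp
  rw [h1, ← Finset.sum_range_add_sum_Ico _ (show k + 1 ≤ s + z from hk), mul_sub, mul_add,
    Finset.mul_sum, Finset.mul_sum, Finset.mul_sum]
  have h2 : ∑ m ∈ Finset.Ico (k + 1) (s + z),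
      weight a (k + 1) * ((1 - satFactor m y) * (blockOut m y / weight a m))
      = ∑ m ∈ Finset.Ico (k + 1) (s + z), weight a (k + 1) / weight a m * blockOut m y
        - ∑ m ∈ Finset.Ico (k + 1) (s + z),
          weight a (k + 1) * (satFactor m y * (blockOut m y / weight a m)) := by
    rw [← Finset.sum_sub_distrib]
    refine Finset.sum_congr rfl fun m hm => ?_
    ring
  rw [h2]
  ring

end Blocks

/-! ### Regularity of the closed loop -/

section Regularity

variable {s z : ℕ} {a : ℕ → ℝ}

theorem exists_clm_eq_triSystem (ω : Fin s → ℝ) (ha : ∀ i, 1 ≤ i → i ≤ s + z → 0 < a i) :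
    ∃ G : State s z × ℝ →L[ℝ] State s z, ∀ y u, G (y, u) = triSystem ω a y u := by
  let G : State s z × ℝ →ₗ[ℝ] State s z :=
    { toFun := fun p => triSystem ω a p.1 p.2
      map_add' := fun p q => by
        refine state_ext (fun k hk => ?_) (fun k hk => ?_)
        · simp only [map_add, blockPos_triSystem, Prod.fst_add]
          ring
        · simp only [map_add, blockOut_triSystem ω ha _ _ hk, Prod.fst_add, Prod.snd_add, mul_add,
            Finset.sum_add_distrib]
          ring
      map_smul' := fun r p => by
        refine state_ext (fun k hk => ?_) (fun k hk => ?_)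
        · simp only [map_smul, blockPos_triSystem, Prod.smul_fst, RingHom.id_apply, smul_eq_mul]
          ring
        · simp only [map_smul, blockOut_triSystem ω ha _ _ hk, Prod.smul_fst, Prod.smul_snd,
            RingHom.id_apply, smul_eq_mul, mul_add, Finset.mul_sum]
          congr 1
          · congr 1
            · ring
            · exact Finset.sum_congr rfl fun m _ => by ring
          · ring }
  exact ⟨LinearMap.toContinuousLinearMap G, fun y u => rfl⟩

theorem abs_sqrt_tailSq_sub_le (k : ℕ) (x y : State s z) :
    |Real.sqrt (1 + tailSq k x) - Real.sqrt (1 + tailSq k y)| ≤ 2 * (s + z : ℕ) * ‖x - y‖ := by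
  have hx1 := one_le_sqrt_one_add_tailSq k x
  have hy1 := one_le_sqrt_one_add_tailSq k y
  have hx2 : Real.sqrt (1 + tailSq k x) ^ 2 = 1 + tailSq k x :=
    Real.sq_sqrt (by linarith [tailSq_nonneg k x])
  have hy2 : Real.sqrt (1 + tailSq k y) ^ 2 = 1 + tailSq k y :=
    Real.sq_sqrt (by linarith [tailSq_nonneg k y])
  have hle : ∀ w : State s z, ∀ m ∈ Finset.Ico k (s + z),
      |blockPos m w| ≤ Real.sqrt (1 + tailSq k w) ∧
        |blockOut m w| ≤ Real.sqrt (1 + tailSq k w) := by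
    intro w m hm
    have h1 : blockSq m w ≤ tailSq k w :=
      Finset.single_le_sum (f := fun m => blockSq m w) (fun m _ => blockSq_nonneg m w) hm
    unfold blockSq at h1
    constructor <;> refine Real.abs_le_sqrt ?_ <;>
      nlinarith [sq_nonneg (blockPos m w), sq_nonneg (blockOut m w)]
  set A := Real.sqrt (1 + tailSq k x)
  set B := Real.sqrt (1 + tailSq k y)
  have hsub : ∀ p q r : ℝ, |p| ≤ A → |q| ≤ B → |p - q| ≤ r → |p ^ 2 - q ^ 2| ≤ r * (A + B) := by
    intro p q r hp hq hr
    rw [show p ^ 2 - q ^ 2 = (p - q) * (p + q) by ring, abs_mul]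
    exact mul_le_mul hr ((abs_add_le p q).trans (add_le_add hp hq)) (abs_nonneg _)
      ((abs_nonneg _).trans hr)
  have hT : |tailSq k x - tailSq k y| ≤ 2 * (s + z : ℕ) * ‖x - y‖ * (A + B) := by
    unfold tailSq
    rw [← Finset.sum_sub_distrib]
    calc _ ≤ ∑ m ∈ Finset.Ico k (s + z), 2 * (‖x - y‖ * (A + B)) := by
          refine (Finset.abs_sum_le_sum_abs _ _).trans (Finset.sum_le_sum fun m hm => ?_)
          have h1 := hsub _ _ ‖x - y‖ (hle x m hm).1 (hle y m hm).1 (by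
            rw [← map_sub]; exact abs_blockPos_le_norm m _)
          have h2 := hsub _ _ ‖x - y‖ (hle x m hm).2 (hle y m hm).2 (by
            rw [← map_sub]; exact abs_blockOut_le_norm m _)
          have h3 : blockSq m x - blockSq m y = (blockPos m x ^ 2 - blockPos m y ^ 2)
            + (blockOut m x ^ 2 - blockOut m y ^ 2) := by unfold blockSq; ring
          rw [h3]
          exact (abs_add_le _ _).trans (by linarith)
      _ ≤ (s + z : ℕ) * (2 * (‖x - y‖ * (A + B))) := by
          rw [Finset.sum_const, nsmul_eq_mul, Nat.card_Ico]
          gcongr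
          omega
      _ = _ := by ring
  have h4 : tailSq k x - tailSq k y = (A - B) * (A + B) := by linear_combination hy2 - hx2
  rw [h4, abs_mul, abs_of_pos (show 0 < A + B by linarith)] at hT
  exact le_of_mul_le_mul_right hT (by linarith)

theorem abs_satFactor_mul_blockOut_sub_le {k : ℕ} (hk : k < s + z) (x y : State s z) :
    |satFactor k x * blockOut k x - satFactor k y * blockOut k y|
      ≤ (1 + 2 * (s + z : ℕ)) * ‖x - y‖ := by
  have hx1 := one_le_sqrt_one_add_tailSq k x
  have hy1 := one_le_sqrt_one_add_tailSq k y
  have h1 := abs_sqrt_tailSq_sub_le k x y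
  have h2 : |satFactor k y * blockOut k y| ≤ 1 := by
    rw [abs_mul, abs_of_pos (satFactor_pos k y)]
    exact (satFactor_mul_abs_le hk y).trans (min_le_left _ _)
  have h3 : satFactor k x * blockOut k x - satFactor k y * blockOut k y
      = satFactor k x * (blockOut k (x - y) - satFactor k y * blockOut k y *
        (Real.sqrt (1 + tailSq k x) - Real.sqrt (1 + tailSq k y))) := by
    rw [map_sub]
    unfold satFactor
    field_simp
    ring
  rw [h3, abs_mul, abs_of_pos (satFactor_pos k x)]
  refine (mul_le_of_le_one_left (abs_nonneg _) (satFactor_le_one k x)).trans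
    ((abs_sub _ _).trans ?_)
  rw [abs_mul, add_mul, one_mul]
  exact add_le_add (abs_blockOut_le_norm k _)
    ((mul_le_of_le_one_left (abs_nonneg _) h2).trans h1)

theorem exists_lipschitzWith_closedLoop (ω : Fin s → ℝ)
    (ha : ∀ i, 1 ≤ i → i ≤ s + z → 0 < a i) :
    ∃ K, LipschitzWith K (closedLoop (triSystem (s := s) (z := z) ω a) (kappa a)) := by
  obtain ⟨G, hG⟩ := exists_clm_eq_triSystem (s := s) (z := z) ω ha
  have hκ := LipschitzWith.of_dist_le' (f := kappa (s := s) (z := z) a)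
    (K := ∑ m ∈ Finset.range (s + z), |weight a (s + z) / weight a m| * (1 + 2 * (s + z : ℕ)))
    fun x y => by
      rw [Real.dist_eq, kappa_eq ha, kappa_eq ha, neg_sub_neg, ← Finset.sum_sub_distrib,
        Finset.sum_mul, dist_eq_norm, norm_sub_rev]
      refine (Finset.abs_sum_le_sum_abs _ _).trans (Finset.sum_le_sum fun m hm => ?_)
      rw [← mul_sub, abs_mul, mul_assoc]
      gcongr
      exact abs_satFactor_mul_blockOut_sub_le (Finset.mem_range.1 hm) _ _
  have h1 : closedLoop (triSystem (s := s) (z := z) ω a) (kappa a)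
      = fun y => G (y, kappa a y) := funext fun y => (hG _ _).symm
  rw [h1]
  exact ⟨_, G.lipschitz.comp (LipschitzWith.id.prodMk hκ)⟩

/-- The linearization of the closed loop is block lower triangular. -/
theorem exists_hasFDerivAt_closedLoop (ω : Fin s → ℝ)
    (ha : ∀ i, 1 ≤ i → i ≤ s + z → 0 < a i) :
    ∃ L : State s z →L[ℝ] State s z,
      HasFDerivAt (closedLoop (triSystem (s := s) (z := z) ω a) (kappa a)) L 0 ∧
      (∀ y, ∀ k < s + z, blockPos k (L y) = blockFreq ω k * blockOut k y) ∧
      ∀ y, ∀ k < s + z, blockOut k (L y) = -blockFreq ω k * blockPos k y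
        - weight a (k + 1) * ∑ m ∈ Finset.range (k + 1), blockOut m y / weight a m := by
  obtain ⟨G, hG⟩ := exists_clm_eq_triSystem (s := s) (z := z) ω ha
  let κ' : State s z →L[ℝ] ℝ :=
    -∑ m ∈ Finset.range (s + z), (weight a (s + z) / weight a m) • blockOut m
  have hκ : HasFDerivAt (kappa (s := s) (z := z) a) κ' 0 := by
    have h1 : kappa (s := s) (z := z) a = fun y => -∑ m ∈ Finset.range (s + z),
      weight a (s + z) / weight a m * (satFactor m y * blockOut m y) := funext (kappa_eq ha)
    rw [h1]
    refine (HasFDerivAt.fun_sum fun m _ => HasFDerivAt.const_mul ?_ _).neg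
    have hd : DifferentiableAt ℝ (satFactor (s := s) (z := z) m) 0 := by
      have h2 : DifferentiableAt ℝ (fun y : State s z => 1 + tailSq m y) 0 := by
        unfold tailSq blockSq
        fun_prop
      have h3 := h2.sqrt (by have := tailSq_nonneg m (0 : State s z); positivity)
      have h4 : Real.sqrt (1 + tailSq m (0 : State s z)) ≠ 0 := by
        have := one_le_sqrt_one_add_tailSq m (0 : State s z)
        positivity
      unfold satFactor
      simp only [one_div]
      exact h3.fun_inv h4
    have h4 := hd.hasFDerivAt.fun_mul (blockOut (s := s) (z := z) m).hasFDerivAt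
    have h5 : satFactor m (0 : State s z) = 1 := by simp [satFactor, tailSq, blockSq]
    simpa [h5] using h4
  refine ⟨G.comp ((ContinuousLinearMap.id ℝ _).prod κ'), ?_, fun y k hk => ?_, fun y k hk => ?_⟩
  · have h1 : closedLoop (triSystem (s := s) (z := z) ω a) (kappa a)
        = fun y => G (y, kappa a y) := funext fun y => (hG _ _).symm
    rw [h1]
    exact G.hasFDerivAt.comp _ ((hasFDerivAt_id _).prodMk hκ)
  · simp [hG, blockPos_triSystem]
  · have hn := (weight_pos ha (le_refl (s + z))).ne'
    have hκy : κ' y = -∑ m ∈ Finset.range (s + z),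
        weight a (s + z) / weight a m * blockOut m y := by
      simp [κ']
    have h1 : weight a (k + 1) / weight a (s + z) * κ' y
        = -(∑ m ∈ Finset.range (s + z), weight a (k + 1) / weight a m * blockOut m y) := by
      rw [hκy, mul_neg, Finset.mul_sum]
      congr 1
      refine Finset.sum_congr rfl fun m hm => ?_
      field_simp
    simp only [ContinuousLinearMap.comp_apply, ContinuousLinearMap.prod_apply,
      ContinuousLinearMap.id_apply, hG, blockOut_triSystem ω ha _ _ hk]
    rw [h1, ← Finset.sum_range_add_sum_Ico _ (show k + 1 ≤ s + z from hk), Finset.mul_sum]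
    have h2 : ∑ m ∈ Finset.range (k + 1), weight a (k + 1) * (blockOut m y / weight a m)
        = ∑ m ∈ Finset.range (k + 1), weight a (k + 1) / weight a m * blockOut m y :=
      Finset.sum_congr rfl fun m _ => by ring
    rw [h2]
    ring

end Regularity

/-! ### Damping of a single block -/

/-- `c` is a damping rate for a block of frequency `ω`: for every gain `a ∈ (0, 1]`, the cross term
`p x₁ x₂` in a Lyapunov function, with `p` depending on `a`, distributes half of the damping
`a x₂²` over both coordinates. An integrator (`ω = 0`) has `x₁ = 0`. -/
def IsDampingRate (ω c : ℝ) : Prop :=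
  ∀ a : ℝ, 0 < a → a ≤ 1 → ∃ p : ℝ, |p| ≤ 1 / 2 ∧ ∀ x₁ x₂ : ℝ, (ω = 0 → x₁ = 0) →
    p * ω * (x₂ ^ 2 - x₁ ^ 2) + a * (|p| * |x₁ * x₂|) ≤
      a * (x₂ ^ 2 / 2 - c * (x₁ ^ 2 + x₂ ^ 2))

theorem IsDampingRate.mono {ω c c' : ℝ} (h : IsDampingRate ω c) (hc : c' ≤ c) :
    IsDampingRate ω c' := by
  intro a ha ha1
  obtain ⟨p, hp, h⟩ := h a ha ha1
  refine ⟨p, hp, fun x₁ x₂ hx => (h x₁ x₂ hx).trans ?_⟩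
  gcongr

theorem exists_isDampingRate (ω : ℝ) : ∃ c, 0 < c ∧ IsDampingRate ω c := by
  rcases eq_or_ne ω 0 with rfl | hω
  · refine ⟨1 / 4, by norm_num, fun a ha _ => ⟨0, by norm_num, fun x₁ x₂ hx => ?_⟩⟩
    simp only [hx rfl]
    have : 0 ≤ a * x₂ ^ 2 := by positivity
    norm_num
    linarith
  have hω' : 0 < |ω| := abs_pos.2 hω
  obtain ⟨k, hk0, hk⟩ : ∃ k, 0 < k ∧ k ≤ min (1 / 8) (min (|ω| / 2) (|ω| ^ 2 / 4)) :=
    ⟨_, by positivity, le_rfl⟩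
  obtain ⟨hk1, hk2, hk3⟩ : k ≤ 1 / 8 ∧ k ≤ |ω| / 2 ∧ k ≤ |ω| ^ 2 / 4 := by simpa using hk
  refine ⟨k / 2, by positivity, fun a ha ha1 => ⟨a * k / ω, ?_, fun x₁ x₂ _ => ?_⟩⟩
  · rw [abs_div, abs_of_pos (by positivity : 0 < a * k), div_le_iff₀ hω']
    nlinarith
  set q := k / |ω| with hq
  have hq2 : q ^ 2 ≤ k / 4 := by
    rw [hq, div_pow, div_le_iff₀ (by positivity)]
    nlinarith
  have h1 : |a * k / ω| = a * q := by
    rw [abs_div, abs_of_pos (by positivity : 0 < a * k), hq]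
    ring
  have h2 : a * k / ω * ω = a * k := by field_simp
  have h3 : q * |x₁ * x₂| ≤ x₂ ^ 2 / 8 + 2 * (k / 4) * x₁ ^ 2 := by
    rw [abs_mul, ← sq_abs x₁, ← sq_abs x₂]
    nlinarith [sq_nonneg (|x₂| - 4 * (q * |x₁|)), sq_nonneg |x₁|]
  have h4 : 0 ≤ q * |x₁ * x₂| := by positivity
  have h5 : a * (a * q * |x₁ * x₂|) ≤ a * (q * |x₁ * x₂|) := by
    rw [mul_assoc]
    exact mul_le_mul_of_nonneg_left (mul_le_of_le_one_left h4 ha1) ha.le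
  rw [h1, h2]
  have h6 : 0 ≤ (1 / 8 - k) * x₂ ^ 2 := mul_nonneg (by linarith) (sq_nonneg _)
  have h7 : a * k * (x₂ ^ 2 - x₁ ^ 2) + a * (q * |x₁ * x₂|)
      ≤ a * (x₂ ^ 2 / 2 - k / 2 * (x₁ ^ 2 + x₂ ^ 2)) := by
    have : k * (x₂ ^ 2 - x₁ ^ 2) + q * |x₁ * x₂| ≤ x₂ ^ 2 / 2 - k / 2 * (x₁ ^ 2 + x₂ ^ 2) := by
      nlinarith [sq_nonneg x₂]
    nlinarith
  linarith

theorem exists_isDampingRate_forall (f : ℕ → ℝ) (n : ℕ) :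
    ∃ c, 0 < c ∧ c ≤ 1 ∧ ∀ k < n, IsDampingRate (f k) c := by
  induction n with
  | zero => exact ⟨1, one_pos, le_rfl, by simp⟩
  | succ n ih =>
    obtain ⟨c, hc, hc1, h⟩ := ih
    obtain ⟨c', hc', h'⟩ := exists_isDampingRate (f n)
    refine ⟨min c c', lt_min hc hc', (min_le_left _ _).trans hc1, fun k hk => ?_⟩
    rcases Nat.lt_succ_iff_lt_or_eq.1 hk with hk | rfl
    · exact (h k hk).mono (min_le_left _ _)
    · exact h'.mono (min_le_right _ _)

theorem abs_mul_add_mul_le {x₁ x₂ v₁ v₂ r d : ℝ} (hr : 0 ≤ r) (hd : 0 ≤ d)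
    (hx : x₁ ^ 2 + x₂ ^ 2 ≤ r ^ 2) (hv : v₁ ^ 2 + v₂ ^ 2 ≤ d ^ 2) :
    |x₁ * v₁ + x₂ * v₂| ≤ r * d := by
  refine abs_le_of_sq_le_sq ?_ (by positivity)
  have h1 : (x₁ ^ 2 + x₂ ^ 2) * (v₁ ^ 2 + v₂ ^ 2) ≤ r ^ 2 * d ^ 2 :=
    mul_le_mul hx hv (by positivity) (by positivity)
  nlinarith [sq_nonneg (x₁ * v₂ - x₂ * v₁)]

/-- The derivative of `S ^ 3 / 3 + p x₁ x₂`, where `S² = 1 + x₁² + x₂²`, along a block with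
saturation factor `σ`, disturbance `D` of its output and disturbance `v` of the state. -/
theorem lyapunov_deriv_le {x₁ x₂ v₁ v₂ D σ S a p ω c g δ r : ℝ} (hr : 0 ≤ r) (hδ : 0 ≤ δ)
    (hrx : r ^ 2 = x₁ ^ 2 + x₂ ^ 2) (hv : v₁ ^ 2 + v₂ ^ 2 ≤ δ ^ 2) (hS : 1 ≤ S) (ha : 0 < a)
    (hσ : 1 / 2 ≤ S * σ) (hσ0 : 0 ≤ σ) (hσ1 : σ ≤ 1) (hp : |p| ≤ 1 / 2)
    (hdamp : p * ω * (x₂ ^ 2 - x₁ ^ 2) + a * (|p| * |x₁ * x₂|) ≤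
      a * (x₂ ^ 2 / 2 - c * (x₁ ^ 2 + x₂ ^ 2))) (hD : |D| + δ ≤ a * g) :
    S * (x₁ * (ω * x₂ + v₁) + x₂ * (-ω * x₁ - a * σ * x₂ + D + v₂))
      + p * (x₁ * (-ω * x₁ - a * σ * x₂ + D + v₂) + x₂ * (ω * x₂ + v₁))
      ≤ a * (r * (2 * S * g) - c * r ^ 2) := by
  have hx1 : |x₁| ≤ r := abs_le_of_sq_le_sq (by nlinarith [sq_nonneg x₂]) hr
  have hx2 : |x₂| ≤ r := abs_le_of_sq_le_sq (by nlinarith [sq_nonneg x₁]) hr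
  have h1 := (abs_le.1 (abs_mul_add_mul_le hr hδ hrx.ge hv)).2
  have h2 : |x₁ * v₂ + x₂ * v₁| ≤ r * δ :=
    abs_mul_add_mul_le hr hδ hrx.ge (by linarith)
  have h3 : x₂ * D ≤ r * |D| := (le_abs_self _).trans (by rw [abs_mul]; gcongr)
  have h4 : |x₁ * D| ≤ r * |D| := by rw [abs_mul]; gcongr
  have h5 : x₁ * v₁ + x₂ * v₂ + x₂ * D ≤ r * (a * g) := by nlinarith
  have h6 : |x₁ * v₂ + x₂ * v₁ + x₁ * D| ≤ r * (a * g) := (abs_add_le _ _).trans (by nlinarith)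
  have hrag : 0 ≤ r * (a * g) := (abs_nonneg _).trans h6
  have h7 : p * (x₁ * v₂ + x₂ * v₁ + x₁ * D) ≤ 1 / 2 * (r * (a * g)) :=
    (le_abs_self _).trans (by rw [abs_mul]; gcongr)
  have h8 : S * (x₁ * v₁ + x₂ * v₂ + x₂ * D) ≤ S * (r * (a * g)) := by gcongr
  have h9 : -(p * (a * σ * (x₁ * x₂))) ≤ a * (|p| * |x₁ * x₂|) := by
    refine (neg_le_abs _).trans ?_
    rw [abs_mul, abs_mul, abs_of_nonneg (by positivity : 0 ≤ a * σ)]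
    have h10 : 0 ≤ a * (|p| * |x₁ * x₂|) := by positivity
    have := mul_le_of_le_one_left h10 hσ1
    linarith
  have h11 : a * (1 / 2) * x₂ ^ 2 ≤ a * (S * σ) * x₂ ^ 2 := by gcongr
  have h12 : r * (a * g) ≤ S * (r * (a * g)) := le_mul_of_one_le_left hrag hS
  rw [hrx]
  linarith

/-! ### The asymptotic gain of a single block -/

section BlockGain

variable {s z : ℕ} {a : ℕ → ℝ}

/-- The Lyapunov function `S ^ 3 / 3 + p x₁ x₂` of a block, where `S ^ 2 = 1 + x₁ ^ 2 + x₂ ^ 2`. The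
cubic growth makes its derivative comparable with the saturated damping at all distances from the
origin. -/
def blockLyap (p : ℝ) (k : ℕ) (y : State s z) : ℝ :=
  Real.sqrt (1 + blockSq k y) ^ 3 / 3 + p * (blockPos k y * blockOut k y)

theorem hasFDerivAt_blockLyap (p : ℝ) (k : ℕ) (y : State s z) :
    HasFDerivAt (blockLyap p k)
      (Real.sqrt (1 + blockSq k y) •
          (blockPos k y • (blockPos k : State s z →L[ℝ] ℝ) + blockOut k y • blockOut k)
        + p • (blockPos k y • (blockOut k : State s z →L[ℝ] ℝ) + blockOut k y • blockPos k)) y := by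
  have h1 : HasFDerivAt (fun y : State s z => 1 + blockSq k y)
      ((2 * blockPos k y) • (blockPos k : State s z →L[ℝ] ℝ)
        + (2 * blockOut k y) • blockOut k) y := by
    have := (((blockPos k : State s z →L[ℝ] ℝ).hasFDerivAt (x := y)).pow 2).add
      (((blockOut k : State s z →L[ℝ] ℝ).hasFDerivAt (x := y)).pow 2)
    simpa [blockSq] using this.const_add 1
  have hpos : 0 < 1 + blockSq k y := by linarith [blockSq_nonneg k y]
  have h2 := (h1.sqrt hpos.ne').pow 3
  have h3 := ((blockPos k : State s z →L[ℝ] ℝ).hasFDerivAt (x := y)).mul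
    ((blockOut k : State s z →L[ℝ] ℝ).hasFDerivAt (x := y))
  have h4 := (h2.mul_const (1 / 3)).add (h3.const_mul p)
  have hS := Real.sqrt_pos.2 hpos
  refine (h4.congr_fderiv ?_).congr_of_eventuallyEq (Eventually.of_forall fun x => ?_)
  · ext v
    simp
    field_simp
  · simp [blockLyap]
    ring

theorem abs_cross_le {p : ℝ} (hp : |p| ≤ 1 / 2) (x₁ x₂ : ℝ) :
    |p * (x₁ * x₂)| ≤ 1 / 4 * (x₁ ^ 2 + x₂ ^ 2) := by
  rw [abs_mul]
  have h1 : |x₁ * x₂| ≤ 1 / 2 * (x₁ ^ 2 + x₂ ^ 2) := by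
    rw [abs_le]
    constructor <;> nlinarith [sq_nonneg (x₁ - x₂), sq_nonneg (x₁ + x₂)]
  calc |p| * |x₁ * x₂| ≤ 1 / 2 * (1 / 2 * (x₁ ^ 2 + x₂ ^ 2)) := by gcongr
    _ = _ := by ring

theorem le_cube_of_sq_eq {S q : ℝ} (hS : 1 ≤ S) (h : S ^ 2 = 1 + q) : 1 + 3 / 2 * q ≤ S ^ 3 := by
  obtain rfl : q = S ^ 2 - 1 := by linarith
  nlinarith [mul_nonneg (sq_nonneg (S - 1)) (by linarith : 0 ≤ 2 * S + 1)]

theorem cube_le_of_sq_eq {S q : ℝ} (hS : 1 ≤ S) (h : S ^ 2 = 1 + q) (hq : 0 ≤ q) (hq1 : q ≤ 1) :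
    S ^ 3 ≤ 1 + 3 * q := by
  have h4 : S ^ 3 ≤ S ^ 4 := pow_le_pow_right₀ hS (by norm_num)
  have h5 : S ^ 4 = (1 + q) ^ 2 := by rw [← h]; ring
  nlinarith

theorem le_blockLyap {p : ℝ} (hp : |p| ≤ 1 / 2) (k : ℕ) (y : State s z) :
    1 / 3 + 1 / 4 * blockSq k y ≤ blockLyap p k y := by
  have hb := blockSq_nonneg k y
  have h1 := le_cube_of_sq_eq (Real.one_le_sqrt.2 (by linarith : 1 ≤ 1 + blockSq k y))
    (Real.sq_sqrt (by linarith))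
  have h2 := (abs_le.1 (abs_cross_le hp (blockPos k y) (blockOut k y))).1
  rw [← blockSq] at h2
  unfold blockLyap
  linarith

theorem blockLyap_le {p : ℝ} (hp : |p| ≤ 1 / 2) {k : ℕ} {y : State s z} (h : blockSq k y ≤ 1) :
    blockLyap p k y ≤ 1 / 3 + 5 / 4 * blockSq k y := by
  have hb := blockSq_nonneg k y
  have h1 := cube_le_of_sq_eq (Real.one_le_sqrt.2 (by linarith : 1 ≤ 1 + blockSq k y))
    (Real.sq_sqrt (by linarith)) hb h
  have h2 := (abs_le.1 (abs_cross_le hp (blockPos k y) (blockOut k y))).2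
  rw [← blockSq] at h2
  unfold blockLyap
  linarith

/-- A block with damping rate `c` has asymptotic gain `24 / c` from small disturbances, once the
blocks above it are at most `1` in norm. -/
theorem eventually_sqrt_blockSq_le {ω : Fin s → ℝ} (hω : ∀ j, ω j ≠ 0) {F : State s z → State s z}
    (hF : Continuous F) {k : ℕ} (hk : k < s + z)
    (hFk : ∀ y, blockPos k (F y) = blockFreq ω k * blockOut k y)
    {c α : ℝ} (hc : 0 < c) (hdamp : IsDampingRate (blockFreq ω k) c) (hα : 0 < α) (hα1 : α ≤ 1)
    {e y : ℝ → State s z} (hy : IsSolutionOn (fun t x => F x + e t) (Ici 0) y) {δ g : ℝ}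
    (he : ∀ᶠ t in atTop, ‖e t‖ ≤ δ) (htail : ∀ᶠ t in atTop, tailSq (k + 1) (y t) ≤ 1)
    (hg : 0 < g) (hgc : 8 * g ≤ c)
    (hD : ∀ᶠ t in atTop, |blockOut k (F (y t)) + blockFreq ω k * blockPos k (y t)
      + α * satFactor k (y t) * blockOut k (y t)| + δ ≤ α * g) :
    ∀ᶠ t in atTop, Real.sqrt (blockSq k (y t)) ≤ 24 / c * g := by
  obtain ⟨p, hp, hdamp⟩ := hdamp α hα hα1
  obtain ⟨T, hT⟩ := eventually_atTop.1 ((he.and htail).and (hD.and (eventually_ge_atTop 0)))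
  have hT0 : 0 ≤ T := (hT T le_rfl).2.2
  have hδ : 0 ≤ δ := (norm_nonneg _).trans (hT T le_rfl).1.1
  set ρ := 8 * g / c with hρ
  have hρ0 : 0 < ρ := by positivity
  have hρ1 : ρ ≤ 1 := (div_le_one hc).2 hgc
  have hρc : 8 * g = c * ρ := by rw [hρ]; field_simp
  have hev := hy.eventually_le hF hT0 (fun t ht => (hT t ht).1.1)
    (fun x => hasFDerivAt_blockLyap p k x) (c := 1 / 3 + 2 * ρ ^ 2) (m := α * (c / 2 * ρ ^ 2))
    (by positivity) ?_
  · filter_upwards [hev] with t ht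
    set r := Real.sqrt (blockSq k (y t)) with hr
    have hr2 : r ^ 2 = blockSq k (y t) := Real.sq_sqrt (blockSq_nonneg _ _)
    have h1 := le_blockLyap hp k (y t)
    have h4 : r ^ 2 ≤ (3 * ρ) ^ 2 := by rw [hr2, mul_pow]; linarith [sq_nonneg ρ]
    have h5 := (abs_le_of_sq_le_sq' h4 (by positivity)).2
    rw [hρ] at h5
    calc r ≤ 3 * (8 * g / c) := h5
      _ = 24 / c * g := by ring
  · intro t ht hV v hv
    obtain ⟨⟨-, ht2⟩, ht3, -⟩ := hT t ht
    have hb0 := blockSq_nonneg k (y t)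
    set r := Real.sqrt (blockSq k (y t)) with hr
    have hr0 : 0 ≤ r := Real.sqrt_nonneg _
    have hr2 : r ^ 2 = blockSq k (y t) := Real.sq_sqrt hb0
    set S := Real.sqrt (1 + blockSq k (y t)) with hSdef
    have hS2 : S ^ 2 = 1 + r ^ 2 := by rw [hr2]; exact Real.sq_sqrt (by linarith)
    have hS : 1 ≤ S := Real.one_le_sqrt.2 (by linarith)
    have hSσ : 1 / 2 ≤ S * satFactor k (y t) := by
      have h1 : Real.sqrt (1 + tailSq k (y t)) ≤ 2 * S := by
        rw [Real.sqrt_le_left (by positivity), tailSq_eq hk, mul_pow, hS2, hr2]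
        linarith
      have h2 := one_le_sqrt_one_add_tailSq k (y t)
      unfold satFactor
      rw [mul_one_div, le_div_iff₀ (by positivity)]
      linarith
    have hv2 : blockPos k v ^ 2 + blockOut k v ^ 2 ≤ δ ^ 2 :=
      (blockSq_le_norm_sq k v).trans (by gcongr)
    have hmain := lyapunov_deriv_le hr0 hδ hr2 hv2 hS hα hSσ (satFactor_pos k _).le
      (satFactor_le_one k _) hp (hdamp _ _ fun h => blockPos_eq_zero hω h (y t)) ht3
    -- outside of the sublevel set the block has norm at least `ρ`
    have hρr : ρ ≤ r := by
      by_contra! hlt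
      have h1 : r ^ 2 < ρ ^ 2 := by gcongr
      have h2 : ρ ^ 2 ≤ 1 := pow_le_one₀ hρ0.le hρ1
      rw [hr2] at h1
      have h3 := blockLyap_le hp (by linarith : blockSq k (y t) ≤ 1)
      linarith [sq_nonneg ρ]
    have hSr : S ≤ 1 + r := by
      refine (abs_le_of_sq_le_sq' ?_ (by positivity)).2
      have : (1 + r) ^ 2 = 1 + r ^ 2 + 2 * r := by ring
      linarith
    have hfin : r * (2 * S * g) - c * r ^ 2 ≤ -(c / 2 * ρ ^ 2) := by
      have h1 : 2 * S * g ≤ 2 * (1 + r) * g := by gcongr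
      have h2 : 8 * g ≤ c * r := by
        rw [hρc]
        gcongr
      have h2' : 8 * g * r ≤ c * r := by gcongr
      have h3 : r * (2 * S * g) ≤ r * (c / 2 * r) :=
        mul_le_mul_of_nonneg_left (by linarith) hr0
      have h4 : c / 2 * ρ ^ 2 ≤ c / 2 * r ^ 2 := by gcongr
      linarith
    have hfin' := mul_le_mul_of_nonneg_left hfin hα.le
    rw [mul_neg] at hfin'
    refine le_trans (le_of_eq ?_) (hmain.trans hfin')
    simp only [_root_.add_apply, _root_.smul_apply, smul_eq_mul, map_add, hFk]
    ring

end BlockGain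

/-! ### Stability from a quadratic Lyapunov function -/

section Stability

variable {E : Type*} [NormedAddCommGroup E] [NormedSpace ℝ E]

theorem isSolutionOn_add_zero {F : E → E} {I : Set ℝ} {x : ℝ → E} :
    IsSolutionOn (fun t x => F x + (0 : ℝ → E) t) I x ↔ IsSolutionOn (fun _ => F) I x := by
  simp [IsSolutionOn]

variable [CompleteSpace E]

/-- A Lyapunov function for the linearization yields stability of the nonlinear system. -/
theorem stableOrigin_of_lyapunov {F : E → E} {L : E →L[ℝ] E} (hF : Continuous F) (hF0 : F 0 = 0)
    (hFL : HasFDerivAt F L 0) {V : E → ℝ} {V' : E → E →L[ℝ] ℝ}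
    (hV : ∀ x, HasFDerivAt V (V' x) x) {c₁ c₂ c₃ κ : ℝ} (hc₁ : 0 < c₁) (hc₂ : 0 < c₂)
    (hc₃ : 0 < c₃) (hκ : 0 < κ) (h₁ : ∀ x, c₁ * ‖x‖ ^ 2 ≤ V x) (h₂ : ∀ x, V x ≤ c₂ * ‖x‖ ^ 2)
    (h₃ : ∀ x v, V' x v ≤ c₃ * ‖x‖ * ‖v‖) (hL : ∀ x, V' x (L x) ≤ -κ * ‖x‖ ^ 2) :
    StableOrigin F := by
  intro ε hε
  have ho := hFL.isLittleO.def (show 0 < κ / (2 * c₃) by positivity)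
  obtain ⟨r, hr, hball⟩ := Metric.eventually_nhds_iff.1 ho
  have hdec : ∀ x, ‖x‖ < r → V' x (F x) ≤ -(κ / 2) * ‖x‖ ^ 2 := by
    intro x hx
    have h := hball (y := x) (by simpa using hx)
    simp only [hF0, sub_zero] at h
    have h' : V' x (F x) = V' x (L x) + V' x (F x - L x) := by rw [← map_add]; simp
    have h4 : c₃ * ‖x‖ * ‖F x - L x‖ ≤ c₃ * ‖x‖ * (κ / (2 * c₃) * ‖x‖) := by gcongr
    have h5 : c₃ * ‖x‖ * (κ / (2 * c₃) * ‖x‖) = κ / 2 * ‖x‖ ^ 2 := by field_simp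
    linarith [hL x, h₃ x (F x - L x)]
  set ε₁ := min ε (r / 2) with hε₁
  have hε₁0 : 0 < ε₁ := lt_min hε (by positivity)
  have hle : ∀ x, V x ≤ c₁ * ε₁ ^ 2 → ‖x‖ ≤ ε₁ := by
    intro x hx
    have := le_of_mul_le_mul_left ((h₁ x).trans hx) hc₁
    exact (abs_le_of_sq_le_sq' this hε₁0.le).2
  refine ⟨Real.sqrt (c₁ / c₂) * ε₁, by positivity, fun x hx hx0 t ht => ?_⟩
  refine (hle (x t) ?_).trans (min_le_left _ _)
  refine (isSolutionOn_add_zero.2 hx).le_of_decreasing hF le_rfl (δ := 0)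
    (fun _ _ => by simp) hV (m := κ / 2 * (c₁ * ε₁ ^ 2 / c₂)) ?_ (by positivity) ?_ t ht
  · have h4 : ‖x 0‖ ^ 2 ≤ (Real.sqrt (c₁ / c₂) * ε₁) ^ 2 := by gcongr
    rw [mul_pow, Real.sq_sqrt (by positivity)] at h4
    calc V (x 0) ≤ c₂ * ‖x 0‖ ^ 2 := h₂ _
      _ ≤ c₂ * (c₁ / c₂ * ε₁ ^ 2) := by gcongr
      _ = c₁ * ε₁ ^ 2 := by field_simp
  · intro u _ hu v hv
    obtain rfl : v = 0 := norm_le_zero_iff.1 hv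
    rw [add_zero]
    refine (hdec _ ((hle _ hu.le).trans_lt ?_)).trans ?_
    · exact (min_le_right _ _).trans_lt (by linarith)
    · have h4 : c₁ * ε₁ ^ 2 / c₂ ≤ ‖x u‖ ^ 2 := by
        rw [div_le_iff₀ hc₂, ← hu]
        linarith [h₂ (x u)]
      rw [neg_mul]
      gcongr

theorem linearAS_of_lyapunov {L : E →L[ℝ] E} {V : E → ℝ} {V' : E → E →L[ℝ] ℝ}
    (hV : ∀ x, HasFDerivAt V (V' x) x) {c₁ c₂ c₃ κ : ℝ} (hc₁ : 0 < c₁) (hc₂ : 0 < c₂)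
    (hc₃ : 0 < c₃) (hκ : 0 < κ) (h₁ : ∀ x, c₁ * ‖x‖ ^ 2 ≤ V x) (h₂ : ∀ x, V x ≤ c₂ * ‖x‖ ^ 2)
    (h₃ : ∀ x v, V' x v ≤ c₃ * ‖x‖ * ‖v‖) (hL : ∀ x, V' x (L x) ≤ -κ * ‖x‖ ^ 2) :
    LinearAS L := by
  refine ⟨stableOrigin_of_lyapunov L.continuous (map_zero L) L.hasFDerivAt hV hc₁ hc₂ hc₃ hκ h₁ h₂
    h₃ hL, 1, one_pos, fun x hx _ => ?_⟩
  rw [Metric.tendsto_nhds]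
  intro ε hε
  have := (isSolutionOn_add_zero.2 hx).eventually_le L.continuous le_rfl (δ := 0)
    (fun _ _ => by simp) hV (c := c₁ * (ε / 2) ^ 2) (m := κ * (c₁ * (ε / 2) ^ 2 / c₂))
    (by positivity) (fun t _ ht v hv => by
      obtain rfl : v = 0 := norm_le_zero_iff.1 hv
      rw [add_zero]
      refine (hL _).trans ?_
      have h4 : c₁ * (ε / 2) ^ 2 / c₂ ≤ ‖x t‖ ^ 2 := by
        rw [div_le_iff₀ hc₂]
        linarith [h₂ (x t)]
      rw [neg_mul]
      gcongr)
  filter_upwards [this] with t ht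
  have h4 := le_of_mul_le_mul_left ((h₁ _).trans ht) hc₁
  have h5 := (abs_le_of_sq_le_sq' h4 (by positivity)).2
  rw [dist_zero_right]
  linarith

end Stability

/-- Weights making a lower triangular family of quadratic estimates negative definite: each
further weight is chosen small compared with the decay already obtained. -/
theorem exists_weights (n : ℕ) (α : ℕ → ℝ) (hα : ∀ k < n, 0 < α k) (b : ℕ → ℕ → ℝ) :
    ∃ (w : ℕ → ℝ) (κ : ℝ), (∀ k < n, 0 < w k) ∧ 0 < κ ∧ ∀ r : ℕ → ℝ,
      ∑ k ∈ Finset.range n, w k * (r k * ∑ m ∈ Finset.range k, b k m * r m - α k * r k ^ 2)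
        ≤ -κ * ∑ k ∈ Finset.range n, r k ^ 2 := by
  induction n with
  | zero => exact ⟨fun _ => 1, 1, by simp, one_pos, by simp⟩
  | succ n ih =>
    obtain ⟨w, κ, hw, hκ, h⟩ := ih fun k hk => hα k (by omega)
    have hαn := hα n (by omega)
    set B := ∑ m ∈ Finset.range n, b n m ^ 2 with hB
    have hB0 : 0 ≤ B := by positivity
    set l := κ * α n / (B + 1) with hl
    have hl0 : 0 < l := by positivity
    have hlB : l * B / α n ≤ κ := by
      rw [hl]
      rw [div_mul_eq_mul_div, div_div, div_le_iff₀ (by positivity)]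
      nlinarith [mul_pos hκ hαn]
    refine ⟨fun k => if k = n then l else w k, min (κ / 2) (l * α n / 2), fun k hk => ?_,
      by positivity, fun r => ?_⟩
    · dsimp only
      split_ifs with hkn
      · exact hl0
      · exact hw k (by omega)
    · rw [Finset.sum_range_succ, Finset.sum_range_succ _ n]
      have e1 : ∑ k ∈ Finset.range n, (if k = n then l else w k) *
          (r k * ∑ m ∈ Finset.range k, b k m * r m - α k * r k ^ 2)
          = ∑ k ∈ Finset.range n, w k *
          (r k * ∑ m ∈ Finset.range k, b k m * r m - α k * r k ^ 2) :=
        Finset.sum_congr rfl fun k hk => by rw [if_neg (Finset.mem_range.1 hk).ne]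
      rw [e1]
      simp only [if_true]
      have e2 := h r
      set R := ∑ k ∈ Finset.range n, r k ^ 2 with hR
      have hR0 : 0 ≤ R := by positivity
      set Q := ∑ m ∈ Finset.range n, b n m * r m with hQ
      have e3 : Q ^ 2 ≤ B * R := Finset.sum_mul_sq_le_sq_mul_sq _ _ _
      have e4 : r n * Q ≤ α n / 2 * r n ^ 2 + Q ^ 2 / (2 * α n) := by
        have : 0 ≤ (α n * r n - Q) ^ 2 / (2 * α n) := by positivity
        have e : (α n * r n - Q) ^ 2 / (2 * α n)
            = α n / 2 * r n ^ 2 + Q ^ 2 / (2 * α n) - r n * Q := by field_simp; ring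
        linarith
      have e5 : l * (Q ^ 2 / (2 * α n)) ≤ κ / 2 * R := by
        calc l * (Q ^ 2 / (2 * α n)) ≤ l * (B * R / (2 * α n)) := by gcongr
          _ = l * B / α n * R / 2 := by field_simp
          _ ≤ κ * R / 2 := by gcongr
          _ = κ / 2 * R := by ring
      have e6 : l * (r n * Q - α n * r n ^ 2) ≤ κ / 2 * R - l * α n / 2 * r n ^ 2 := by
        have := mul_le_mul_of_nonneg_left e4 hl0.le
        linarith
      have e7 : min (κ / 2) (l * α n / 2) * R ≤ κ / 2 * R := by
        gcongr; exact min_le_left _ _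
      have e8 : min (κ / 2) (l * α n / 2) * r n ^ 2 ≤ l * α n / 2 * r n ^ 2 := by
        gcongr; exact min_le_right _ _
      linarith

section Linearization

variable {s z : ℕ} {a : ℕ → ℝ}

/-- A weighted sum of quadratic Lyapunov functions of the blocks. -/
def quadLyap (w p : ℕ → ℝ) (y : State s z) : ℝ :=
  ∑ k ∈ Finset.range (s + z), w k * (blockSq k y / 2 + p k * (blockPos k y * blockOut k y))

/-- The derivative of `quadLyap`. -/
def quadLyapDeriv (w p : ℕ → ℝ) (y : State s z) : State s z →L[ℝ] ℝ :=
  ∑ k ∈ Finset.range (s + z), w k •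
    ((blockPos k y • (blockPos k : State s z →L[ℝ] ℝ) + blockOut k y • blockOut k)
      + p k • (blockPos k y • (blockOut k : State s z →L[ℝ] ℝ) + blockOut k y • blockPos k))

theorem hasFDerivAt_quadLyap (w p : ℕ → ℝ) (y : State s z) :
    HasFDerivAt (quadLyap w p) (quadLyapDeriv w p y) y := by
  unfold quadLyap quadLyapDeriv
  refine HasFDerivAt.fun_sum fun k _ => HasFDerivAt.const_mul ?_ _
  have hP := (blockPos k : State s z →L[ℝ] ℝ).hasFDerivAt (x := y)
  have hO := (blockOut k : State s z →L[ℝ] ℝ).hasFDerivAt (x := y)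
  have h1 := (((hP.pow 2).add (hO.pow 2)).mul_const (1 / 2)).add ((hP.mul hO).const_mul (p k))
  refine (h1.congr_fderiv ?_).congr_of_eventuallyEq (Eventually.of_forall fun x => ?_)
  · ext v
    simp
    ring
  · simp [blockSq]
    ring

variable {w p : ℕ → ℝ}

theorem exists_le_quadLyap (hw : ∀ k < s + z, 0 < w k) (hp : ∀ k < s + z, |p k| ≤ 1 / 2) :
    ∃ c, 0 < c ∧ ∀ y : State s z, c * ‖y‖ ^ 2 ≤ quadLyap w p y := by
  obtain ⟨c, hc, h⟩ : ∃ c, 0 < c ∧ ∀ k < s + z, c ≤ w k := by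
    clear hp
    generalize s + z = n at hw
    induction n with
    | zero => exact ⟨1, one_pos, by simp⟩
    | succ n ih =>
      obtain ⟨c, hc, h⟩ := ih fun k hk => hw k (by omega)
      refine ⟨min c (w n), lt_min hc (hw n (by omega)), fun k hk => ?_⟩
      rcases Nat.lt_succ_iff_lt_or_eq.1 hk with hk | rfl
      · exact (min_le_left _ _).trans (h k hk)
      · exact min_le_right _ _
  refine ⟨c / 4, by positivity, fun y => ?_⟩
  rw [norm_sq_eq_sum_blockSq, Finset.mul_sum]
  refine Finset.sum_le_sum fun k hk => ?_
  have hk := Finset.mem_range.1 hk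
  have h1 := (abs_le.1 (abs_cross_le (hp k hk) (blockPos k y) (blockOut k y))).1
  rw [← blockSq] at h1
  have hb := blockSq_nonneg k y
  calc c / 4 * blockSq k y ≤ w k * (1 / 4 * blockSq k y) := by
        have := mul_le_mul_of_nonneg_right (h k hk) hb
        linarith
    _ ≤ _ := by
        have := hw k hk
        gcongr
        linarith

theorem quadLyap_le (hw : ∀ k < s + z, 0 < w k) (hp : ∀ k < s + z, |p k| ≤ 1 / 2)
    (y : State s z) : quadLyap w p y ≤ (∑ k ∈ Finset.range (s + z), w k) * ‖y‖ ^ 2 := by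
  rw [Finset.sum_mul]
  refine Finset.sum_le_sum fun k hk => ?_
  have hk := Finset.mem_range.1 hk
  have h1 := (abs_le.1 (abs_cross_le (hp k hk) (blockPos k y) (blockOut k y))).2
  rw [← blockSq] at h1
  have := hw k hk
  gcongr
  linarith [blockSq_le_norm_sq k y, blockSq_nonneg k y]

theorem quadLyapDeriv_le (hw : ∀ k < s + z, 0 < w k) (hp : ∀ k < s + z, |p k| ≤ 1 / 2)
    (y v : State s z) :
    quadLyapDeriv w p y v ≤ (2 * ∑ k ∈ Finset.range (s + z), w k) * ‖y‖ * ‖v‖ := by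
  unfold quadLyapDeriv
  rw [_root_.sum_apply, mul_assoc, mul_assoc, Finset.sum_mul, Finset.mul_sum]
  refine Finset.sum_le_sum fun k hk => ?_
  have hk := Finset.mem_range.1 hk
  have hy := blockSq_le_norm_sq k y
  have hv := blockSq_le_norm_sq k v
  have h1 := abs_mul_add_mul_le (norm_nonneg y) (norm_nonneg v) hy hv
  have h2 := abs_mul_add_mul_le (norm_nonneg y) (norm_nonneg v) hy
    ((add_comm (blockOut k v ^ 2) _).trans_le hv)
  have h3 : p k * (blockPos k y * blockOut k v + blockOut k y * blockPos k v)
      ≤ 1 / 2 * (‖y‖ * ‖v‖) := by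
    refine (le_abs_self _).trans ?_
    rw [abs_mul]
    exact mul_le_mul (hp k hk) h2 (abs_nonneg _) (by norm_num)
  have := hw k hk
  have h4 : 0 ≤ ‖y‖ * ‖v‖ := by positivity
  simp only [_root_.add_apply, _root_.smul_apply, smul_eq_mul]
  calc _ ≤ w k * (2 * (‖y‖ * ‖v‖)) := by
        gcongr
        linarith [(abs_le.1 h1).2]
    _ = _ := by ring

/-- The linearization has a quadratic Lyapunov function. -/
theorem exists_quadLyap {ω : Fin s → ℝ} (hω : ∀ j, ω j ≠ 0)
    (ha : ∀ i, 1 ≤ i → i ≤ s + z → 0 < a i) (ha1 : ∀ i, 1 ≤ i → i ≤ s + z → a i ≤ 1)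
    {L : State s z →L[ℝ] State s z}
    (hLp : ∀ y, ∀ k < s + z, blockPos k (L y) = blockFreq ω k * blockOut k y)
    (hLo : ∀ y, ∀ k < s + z, blockOut k (L y) = -blockFreq ω k * blockPos k y
        - weight a (k + 1) * ∑ m ∈ Finset.range (k + 1), blockOut m y / weight a m) :
    ∃ (w p : ℕ → ℝ) (κ : ℝ), (∀ k < s + z, 0 < w k) ∧ (∀ k < s + z, |p k| ≤ 1 / 2) ∧ 0 < κ ∧
      ∀ y, quadLyapDeriv w p y (L y) ≤ -κ * ‖y‖ ^ 2 := by
  obtain ⟨c, hc, -, hdamp⟩ := exists_isDampingRate_forall (blockFreq ω) (s + z)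
  have hex : ∀ k, ∃ p, k < s + z → |p| ≤ 1 / 2 ∧ ∀ x₁ x₂ : ℝ, (blockFreq ω k = 0 → x₁ = 0) →
      p * blockFreq ω k * (x₂ ^ 2 - x₁ ^ 2) + a (k + 1) * (|p| * |x₁ * x₂|) ≤
        a (k + 1) * (x₂ ^ 2 / 2 - c * (x₁ ^ 2 + x₂ ^ 2)) := by
    intro k
    by_cases hk : k < s + z
    · obtain ⟨p, hp⟩ := hdamp k hk (a (k + 1)) (ha _ (by omega) hk) (ha1 _ (by omega) hk)
      exact ⟨p, fun _ => hp⟩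
    · exact ⟨0, fun h => absurd h hk⟩
  choose p hp using hex
  obtain ⟨w, κ, hw, hκ, h⟩ := exists_weights (s + z) (fun k => a (k + 1) * c)
    (fun k hk => mul_pos (ha _ (by omega) hk) hc)
    (fun k m => a (k + 1) * 2 * (weight a k / weight a m))
  refine ⟨w, p, κ, hw, fun k hk => (hp k hk).1, hκ, fun y => ?_⟩
  have hy := h fun k => Real.sqrt (blockSq k y)
  have hnorm : ∑ k ∈ Finset.range (s + z), Real.sqrt (blockSq k y) ^ 2 = ‖y‖ ^ 2 := by
    rw [norm_sq_eq_sum_blockSq]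
    exact Finset.sum_congr rfl fun k _ => Real.sq_sqrt (blockSq_nonneg k y)
  rw [hnorm] at hy
  refine le_trans ?_ hy
  unfold quadLyapDeriv
  rw [_root_.sum_apply]
  refine Finset.sum_le_sum fun k hk => ?_
  have hk := Finset.mem_range.1 hk
  have hwk := hw k hk
  have hak := ha (k + 1) (by omega) hk
  have hPk := weight_pos ha hk.le
  set G := ∑ m ∈ Finset.range k, weight a k / weight a m * Real.sqrt (blockSq m y) with hG
  set D := -(weight a (k + 1) * ∑ m ∈ Finset.range k, blockOut m y / weight a m) with hDdef
  have hD : |D| + 0 ≤ a (k + 1) * G := by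
    rw [add_zero, hDdef, abs_neg, weight_succ, abs_mul, abs_of_pos (by positivity),
      mul_comm (weight a k), mul_assoc]
    gcongr
    rw [hG]
    refine (mul_le_mul_of_nonneg_left (Finset.abs_sum_le_sum_abs _ _) hPk.le).trans ?_
    rw [Finset.mul_sum]
    refine Finset.sum_le_sum fun m hm => ?_
    have hm := Finset.mem_range.1 hm
    have hPm := weight_pos ha (k := m) (by omega)
    rw [abs_div, abs_of_pos hPm, mul_div_assoc', div_mul_eq_mul_div]
    gcongr
    refine Real.abs_le_sqrt ?_
    unfold blockSq
    linarith [sq_nonneg (blockPos m y)]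
  have hmain := lyapunov_deriv_le (v₁ := 0) (v₂ := 0) (S := 1) (σ := 1)
    (Real.sqrt_nonneg (blockSq k y)) le_rfl
    (Real.sq_sqrt (blockSq_nonneg k y)) (by norm_num) le_rfl hak (by norm_num) zero_le_one le_rfl
    (hp k hk).1 ((hp k hk).2 _ _ fun h => blockPos_eq_zero hω h y) hD
  have hLoy : blockOut k (L y) = -blockFreq ω k * blockPos k y - a (k + 1) * blockOut k y + D := by
    rw [hLo y k hk, Finset.sum_range_succ, hDdef, weight_succ]
    field_simp
    ring
  simp only [_root_.add_apply, _root_.smul_apply, smul_eq_mul, hLp y k hk]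
  gcongr
  rw [hLoy]
  have hsum : ∑ m ∈ Finset.range k, a (k + 1) * 2 * (weight a k / weight a m) *
      Real.sqrt (blockSq m y) = a (k + 1) * 2 * G := by
    rw [hG, Finset.mul_sum]
    exact Finset.sum_congr rfl fun m _ => by ring
  rw [hsum]
  linarith

end Linearization

/-! ### Global behaviour of the closed loop -/

section Global

variable {s z : ℕ} {a : ℕ → ℝ}

theorem closedLoop_zero (ω : Fin s → ℝ) (ha : ∀ i, 1 ≤ i → i ≤ s + z → 0 < a i) :
    closedLoop (triSystem (s := s) (z := z) ω a) (kappa a) 0 = 0 := by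
  refine state_ext (fun k _ => ?_) (fun k hk => ?_)
  · simp [blockPos_closedLoop]
  · simp [blockOut_closedLoop ω ha _ hk]

/-- The disturbance of block `k` in the closed loop: the blocks below it act through their
saturated outputs, the blocks above it through the defect of their saturation. -/
theorem abs_disturbance_le (ω : Fin s → ℝ) (ha : ∀ i, 1 ≤ i → i ≤ s + z → 0 < a i)
    (y : State s z) {k : ℕ} (hk : k < s + z) :
    |blockOut k (closedLoop (triSystem ω a) (kappa a) y) + blockFreq ω k * blockPos k y
        + a (k + 1) * satFactor k y * blockOut k y| ≤
      weight a (k + 1) *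
        (∑ m ∈ Finset.range k, min 1 (Real.sqrt (blockSq m y)) / weight a m
          + ∑ m ∈ Finset.Ico (k + 1) (s + z),
            tailSq m y * (Real.sqrt (blockSq m y) / weight a m)) := by
  have hPk := weight_pos ha hk.le
  have hPk1 := weight_pos ha (show k + 1 ≤ s + z from hk)
  have h1 : blockOut k (closedLoop (triSystem ω a) (kappa a) y) + blockFreq ω k * blockPos k y
        + a (k + 1) * satFactor k y * blockOut k y = weight a (k + 1) *
        (∑ m ∈ Finset.Ico (k + 1) (s + z), (1 - satFactor m y) * (blockOut m y / weight a m)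
          - ∑ m ∈ Finset.range k, satFactor m y * (blockOut m y / weight a m)) := by
    rw [blockOut_closedLoop ω ha y hk, Finset.sum_range_succ, weight_succ]
    field_simp
    ring
  rw [h1, abs_mul, abs_of_pos hPk1]
  gcongr
  refine (abs_sub _ _).trans ?_
  rw [add_comm]
  refine add_le_add ((Finset.abs_sum_le_sum_abs _ _).trans (Finset.sum_le_sum fun m hm => ?_))
    ((Finset.abs_sum_le_sum_abs _ _).trans (Finset.sum_le_sum fun m hm => ?_))
  · have hm : m < k := Finset.mem_range.1 hm
    have hPm := weight_pos ha (k := m) (by omega)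
    rw [← mul_div_assoc, abs_div, abs_mul, abs_of_pos hPm, abs_of_pos (satFactor_pos m y)]
    gcongr
    exact satFactor_mul_abs_le (by omega) y
  · have hm := (Finset.mem_Ico.1 hm).2
    have hPm := weight_pos ha hm.le
    rw [abs_mul, abs_div, abs_of_pos hPm,
      abs_of_nonneg (sub_nonneg.2 (satFactor_le_one m y))]
    refine mul_le_mul (one_sub_satFactor_le m y) ?_ (by positivity) (tailSq_nonneg m y)
    gcongr
    refine Real.abs_le_sqrt ?_
    unfold blockSq
    linarith [sq_nonneg (blockPos m y)]

/-- The asymptotic gain of the closed loop, for small inputs. One bound on the constants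
`a 1, …, a (s + z - 1)`, depending only on the frequencies, suffices. -/
theorem exists_asymptotic_gain {ω : Fin s → ℝ} (hω : ∀ j, ω j ≠ 0) :
    ∃ ε : ℝ, 0 < ε ∧ ε ≤ 1 / 2 ∧ ∀ a : ℕ → ℝ, (∀ i, 1 ≤ i → i ≤ s + z → 0 < a i) →
      (∀ i, 1 ≤ i → i ≤ s + z → a i ≤ 1) → (∀ i, 1 ≤ i → i < s + z → a i ≤ ε) →
      ∃ Δ N : ℝ, 0 < Δ ∧ 0 < N ∧ ∀ δ, 0 < δ → δ ≤ Δ → ∀ e y : ℝ → State s z,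
        EventuallyBounded e δ →
        IsSolutionOn (fun t x => closedLoop (triSystem ω a) (kappa a) x + e t) (Ici 0) y →
        EventuallyBounded y (N * δ) := by
  obtain ⟨c, hc, hc1, hdamp⟩ := exists_isDampingRate_forall (blockFreq ω) (s + z)
  set K := 24 / c with hKdef
  have hK : 1 ≤ K := by rw [hKdef, le_div_iff₀ hc]; linarith
  obtain ⟨ε, hε0, hε, hτ1, hτ2, hτ3⟩ :=
    exists_small (s + z) K (show 0 < c / 8 by positivity)
  refine ⟨ε, hε0, hε, fun a ha ha1 haε => ?_⟩
  set M := (1 + K) ^ (s + z) with hM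
  have hM0 : 0 < M := by positivity
  have hn := weight_pos ha (le_refl (s + z))
  have hanti : ∀ k m, m ≤ s + z → k ≤ m → weight a m ≤ weight a k := by
    intro k m hm hkm
    induction m, hkm using Nat.le_induction with
    | base => exact le_rfl
    | succ m hkm ih =>
      rw [weight_succ]
      exact (mul_le_of_le_one_right (weight_pos ha (by omega)).le (ha1 _ (by omega) hm)).trans
        (ih (by omega))
  obtain ⟨KF, hKF⟩ := exists_lipschitzWith_closedLoop (s := s) (z := z) ω ha
  refine ⟨ε * weight a (s + z), (s + z + 1 : ℕ) * (3 * M) / weight a (s + z), by positivity,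
    by positivity, fun δ hδ hδΔ e y he hy => ?_⟩
  set η := δ / weight a (s + z) with hη
  have hη0 : 0 < η := by positivity
  have hηε : η ≤ ε := (div_le_iff₀ hn).2 hδΔ
  obtain ⟨T, -, hT⟩ := he
  have heT : ∀ᶠ t in atTop, ‖e t‖ ≤ δ := eventually_atTop.2 ⟨T, hT⟩
  have hNsq : ∀ l t, Real.sqrt (blockSq l (y t)) ^ 2 = blockSq l (y t) := fun l t =>
    Real.sq_sqrt (blockSq_nonneg _ _)
  have hbound := eventually_le_of_gain (n := s + z) (N := fun m t => Real.sqrt (blockSq m (y t)))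
    (P := weight a) (η := η) (fun _ _ => Real.sqrt_nonneg _)
    (fun m hm => weight_pos ha hm.le) (by simp [weight]) (fun m hm => by
      rw [weight_succ, mul_comm]
      have := weight_pos ha (k := m) (by omega)
      gcongr
      exact haε _ (by omega) hm) hK hη0 hηε hε hτ1 hτ2 hτ3 (fun k hk g hg hgδ htail hsmall => by
      simp only [hNsq] at htail hsmall
      refine eventually_sqrt_blockSq_le hω hKF.continuous hk
        (fun y => blockPos_closedLoop ω a y k) hc (hdamp k hk) (ha _ (by omega) hk)
        (ha1 _ (by omega) hk) hy heT htail hg (by linarith) ?_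
      filter_upwards [hsmall] with t ht
      have hak := ha (k + 1) (by omega) hk
      have h1 := abs_disturbance_le ω ha (y t) hk
      have h2 : δ ≤ weight a (k + 1) * η := by
        rw [hη, mul_div_assoc', le_div_iff₀ hn, mul_comm]
        gcongr
        exact hanti _ _ le_rfl hk
      have h3 := mul_le_mul_of_nonneg_left ht hak.le
      refine le_trans ?_ h3
      refine (add_le_add h1 h2).trans (le_of_eq ?_)
      rw [weight_succ]
      unfold tailSq
      ring)
  obtain ⟨T', hT'⟩ := eventually_atTop.1 hbound
  refine ⟨max T' 1, by positivity, fun t ht => ?_⟩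
  have hb := hT' t ((le_max_left _ _).trans ht)
  have h1 : ‖y t‖ ^ 2 ≤ ((s + z + 1 : ℕ) * (3 * M * η)) ^ 2 := by
    rw [norm_sq_eq_sum_blockSq]
    calc _ ≤ ∑ m ∈ Finset.range (s + z), (3 * M * η) ^ 2 := by
          refine Finset.sum_le_sum fun m hm => ?_
          have hm := Finset.mem_range.1 hm
          rw [← hNsq m t]
          have h2 : weight a m ≤ 1 := by simpa [weight] using hanti 0 m hm.le (Nat.zero_le m)
          have h3 := (hb m hm).trans (mul_le_of_le_one_left (by positivity) h2)
          exact pow_le_pow_left₀ (Real.sqrt_nonneg _) h3 2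
      _ = (s + z : ℕ) * (3 * M * η) ^ 2 := by simp
      _ ≤ _ := by
          rw [mul_pow _ (3 * M * η)]
          gcongr
          push_cast
          nlinarith [(Nat.cast_nonneg s : (0 : ℝ) ≤ s), (Nat.cast_nonneg z : (0 : ℝ) ≤ z)]
  have h2 := (abs_le_of_sq_le_sq' h1 (by positivity)).2
  refine h2.trans (le_of_eq ?_)
  rw [hη]
  ring

end Global

theorem frequency_ne_zero {n s : ℕ} {A : Matrix (Fin n) (Fin n) ℝ} {ω : Fin s → ℝ}
    (hω : IsFrequencyList A ω) (j : Fin s) : ω j ≠ 0 := by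
  classical
  intro h
  have hmem : (ω j : ℂ) * Complex.I ∈ (eigenvalues A).filter fun l => l ≠ 0 := by
    unfold IsFrequencyList at hω
    convert Multiset.mem_add.2 (Or.inl (Multiset.mem_map_of_mem
      (fun j : Fin s => (ω j : ℂ) * Complex.I) (Finset.mem_univ_val j)))
  exact (Multiset.mem_filter.1 hmem).2 (by simp [h])

end CriticalSystem
end

theorem proposition1 (n : ℕ) (hn : 1 ≤ n)
    (A : Matrix (Fin n) (Fin n) ℝ) (b : Fin n → ℝ)
    (hctrl : CriticalSystem.Controllable A b)
    (hcrit : CriticalSystem.AllCritical A)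
    (s z μ : ℕ) (hs : s = CriticalSystem.numPairs A) (hz : z = CriticalSystem.zeroMult A)
    (hμ : μ = s + z)
    (ω : Fin s → ℝ) (hω : CriticalSystem.IsFrequencyList A ω) :
    ∃ abar : ℕ → ℝ → ℝ,
      (∀ i : ℕ, 1 ≤ i → i < μ → ∀ r : ℝ, 0 < r → 0 < abar i r) ∧
      ∀ a : ℕ → ℝ,
        (0 < a μ ∧ a μ ≤ 1) →
        (∀ i : ℕ, 1 ≤ i → i < μ → 0 < a i ∧ a i ≤ abar i (a (i + 1))) →
          CriticalSystem.SISSLStabilizing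
            (CriticalSystem.triSystem (s := s) (z := z) ω a) (CriticalSystem.kappa a) ∧
          CriticalSystem.LinearizationAS
            (CriticalSystem.closedLoop
              (CriticalSystem.triSystem (s := s) (z := z) ω a) (CriticalSystem.kappa a)) := by
  open CriticalSystem Filter Topology in
  subst hμ
  have hω0 := frequency_ne_zero hω
  obtain ⟨ε, hε0, hε, hgain⟩ := exists_asymptotic_gain (z := z) hω0
  refine ⟨fun _ _ => ε, fun _ _ _ _ _ => hε0, fun a haμ hai => ?_⟩
  have ha : ∀ i, 1 ≤ i → i ≤ s + z → 0 < a i := fun i hi hin => by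
    rcases hin.lt_or_eq with h | rfl
    · exact (hai i hi h).1
    · exact haμ.1
  have ha1 : ∀ i, 1 ≤ i → i ≤ s + z → a i ≤ 1 := fun i hi hin => by
    rcases hin.lt_or_eq with h | rfl
    · exact (hai i hi h).2.trans (by linarith)
    · exact haμ.2
  obtain ⟨Δ, N, hΔ, hN, hbd⟩ := hgain a ha ha1 fun i hi hin => (hai i hi hin).2
  obtain ⟨KF, hKF⟩ := exists_lipschitzWith_closedLoop (s := s) (z := z) ω ha
  obtain ⟨L, hFL, hLp, hLo⟩ := exists_hasFDerivAt_closedLoop (s := s) (z := z) ω ha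
  obtain ⟨w, p, κ, hw, hp, hκ, hL⟩ := exists_quadLyap hω0 ha ha1 hLp hLo
  obtain ⟨c₁, hc₁, h₁⟩ := exists_le_quadLyap hw hp
  have hW : 0 ≤ ∑ k ∈ Finset.range (s + z), w k :=
    Finset.sum_nonneg fun k hk => (hw k (Finset.mem_range.1 hk)).le
  set c₂ := 2 * ∑ k ∈ Finset.range (s + z), w k + 1 with hc₂
  have hc₂0 : 0 < c₂ := by positivity
  have h₂ : ∀ y, quadLyap w p y ≤ c₂ * ‖y‖ ^ 2 := fun y => (quadLyap_le hw hp y).trans (by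
    gcongr
    linarith)
  have h₃ : ∀ y v, quadLyapDeriv w p y v ≤ c₂ * ‖y‖ * ‖v‖ := fun y v =>
    (quadLyapDeriv_le hw hp y v).trans (by
      gcongr
      linarith)
  refine ⟨⟨⟨?_, ?_, fun x hx => ?_⟩, Δ, N, hΔ, hN, fun δ hδ hδΔ e hem heb he => ⟨?_, ?_⟩⟩,
    L, hFL, ?_⟩
  · simpa using forwardComplete_of_lipschitz hKF (e := 0)
      MeasureTheory.aestronglyMeasurable_zero ⟨0, by simp⟩
  · exact stableOrigin_of_lyapunov hKF.continuous (closedLoop_zero ω ha) hFL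
      (hasFDerivAt_quadLyap w p) hc₁ hc₂0 hc₂0 hκ h₁ h₂ h₃ hL
  · -- the asymptotic gain, applied to the zero input and arbitrarily small `δ`
    rw [Metric.tendsto_nhds]
    intro ρ hρ
    obtain ⟨T, -, hT⟩ := hbd (min Δ (ρ / (2 * N))) (lt_min hΔ (by positivity)) (min_le_left _ _)
      0 x ⟨1, one_pos, fun t _ => by simp [hΔ.le]; positivity⟩
      (isSolutionOn_add_zero.2 hx)
    filter_upwards [eventually_ge_atTop T] with t ht
    rw [dist_zero_right]
    calc ‖x t‖ ≤ N * min Δ (ρ / (2 * N)) := hT t ht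
      _ ≤ N * (ρ / (2 * N)) := by gcongr; exact min_le_right _ _
      _ = ρ / 2 := by field_simp
      _ < ρ := by linarith
  · exact forwardComplete_of_lipschitz hKF hem.aestronglyMeasurable heb
  · exact fun x hx => hbd δ hδ hδΔ e x he hx
  · exact linearAS_of_lyapunov (hasFDerivAt_quadLyap w p) hc₁ hc₂0 hc₂0 hκ h₁ h₂ h₃ hL
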